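/- **Setting.** Let $N$ be a regular network of valency $\vartheta$: a finite directed multigraph in which every cell is the target of exactly $\vartheta$ edges, with adjacency matrix $A$ ($A_{cc'}$ is the number of edges from $c'$ to $c$). A coloring (equivalence relation on the cells) is *balanced* if for any two cells of the same color there is a bijection of their input sets that preserves the colors of the source cells. $\bowtie\preceq\bowtie'$ means that $\bowtie$ refines or equals $\bowtie'$, and $\prec$ is the strict relation. For a balanced coloring $\bowtie$ let $\Delta_\bowtie=\{x: x_c=x_d \text{ if } c\bowtie d\}$, and let $N/\bowtie$ be the quotient network, whose cells are the color classes and whose edges into a class are the edges of $N$ into a representative. Let $\bowtie_=$ be the coloring into singletons. For $\mu\in\mathbb R$ consider functions $f:\mathbb R\times\mathbb R^\vartheta\times\mathbb R\to\mathbb R$, $f(x_0,x_1,\dots,x_\vartheta,\lambda)$, that are smooth near the origin, symmetric in $x_1,\dots,x_\vartheta$, vanish at $(0,\dots,0,\lambda)$ for all $\lambda$, and satisfy the bifurcation condition $f_0+\mu f_1=0$, where $f_i=\partial f/\partial x_i(0)$. *Generically* means: for all such $f$ in an open dense subset. Put $(f^N(x,\lambda))_c=f(x_c,(x_{s(e)})_{e\in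 I(c)},\lambda)$, where $I(c)$ is the set of edges into $c$ and $s(e)$ is the source of $e$, and let $J_f^N$ be the Jacobian of $f^N(\cdot,0)$ at $0$. A *bifurcation branch* of $f$ on $N$ is a differentiable $b=(b_N,b_\lambda):[0,\delta[\,\to\mathbb R^{|N|}\times\mathbb R$ with $b(0)=0$ and, for $z>0$, $f^N(b(z))=0$, $b_\lambda(z)\ne0$, $b_N(z)\neq0$. It has *exactly synchrony* $\bowtie$ if $b_N([0,\delta[)\subseteq\Delta_\bowtie$ and $b_N([0,\delta'[)\not\subseteq\Delta_{\bowtie'}$ for every balanced $\bowtie'$ with $\bowtie\prec\bowtie'$ and every $0<\delta'\le\delta$. $\bowtie$ is *$\mu$-submaximal of type $j$* if $\mu$ is an eigenvalue of $A$ of multiplicity $>1$ and there are $j$ distinct balanced colorings $\bowtie_1,\dots,\bowtie_j$ (its $\mu$-simple components) such that $\bowtie\prec\bowtie_i$, $\bowtie_i\not\preceq\bowtie_{i'}$ for $i\ne i'$, $\mu$ is an eigenvalue of multiplicity $1$ of the adjacency matrix of $N/\bowtie_i$, and, for every other balanced $\bowtie'$ with $\bowtie\prec\bowtie'$, either $\mu$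 is not an eigenvalue of the adjacency matrix of $N/\bowtie'$ or $\bowtie_i\preceq\bowtie'$ for some $i$. (Multiplicities are algebraic.) For a network $M$ let $v_1,\dots,v_m$ be a basis of $\ker J_f^M$ and $v_1^*,\dots,v_m^*$ the basis of $(\operatorname{ran}J_f^M)^\perp$ with $\langle v_i^*,v_j\rangle=\delta_{ij}$. Let $g(y,\lambda)\in\mathbb R^m$ be the Lyapunov–Schmidt reduction of $f^M=0$ at the origin, $g_i(y,\lambda)=\langle v_i^*,f^M(\sum_l y_lv_l+W(y,\lambda),\lambda)\rangle$, where $W(y,\lambda)\in(\ker J_f^M)^\perp$ is the smooth solution with $W(0,0)=0$ of $f^M(\sum_l y_lv_l+W(y,\lambda),\lambda)\in(\operatorname{ran}J_f^M)^\perp$. Write $k(M,\mu)=k$ if, generically, the Taylor expansion at $0$ of $g(\cdot,0)$ starts with terms of degree exactly $k$; let $Q_k$ be its homogeneous part of degree $k$. With $a=\frac{\partial^2 f}{\partial x_0\partial\lambda}(0)+\mu\frac{\partial^2 f}{\partial x_1\partial\lambda}(0)$ put, for $u\in S^{m-1}$ and $\eta\in\mathbb R$, $h(u,0,\eta)=\eta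 a u+Q_k(u)$, $\tilde\eta(u)=-\langle Q_k(u),u\rangle/a$, $\tilde h(u)=h(u,0,\tilde\eta(u))$. *Condition (H1a) holds for $f$ and $M$* if for every $\tilde u\in S^{m-1}$ and every balanced coloring $\bowtie'$ of $M$ with $\tilde h(\tilde u)=0$, $\bowtie_=\prec\bowtie'$ and $\sum_i\tilde u_iv_i\notin\Delta_{\bowtie'}$, the derivative of $h(\cdot,0,\cdot)$ at $(\tilde u,\tilde\eta(\tilde u))$ on $T_{\tilde u}S^{m-1}\times\mathbb R$ is non-singular. **Theorem.** Let $\bowtie$ be a balanced coloring of $N$, let $\mu$ be a semisimple eigenvalue of $A$ (algebraic and geometric multiplicity agree), and suppose $k(N/\bowtie,\mu)=2$. Then generically the following holds for every $f$ such that $0$ is an isolated zero of $f^N(\cdot,0)$ and $\dim(\ker J_f^N\cap\Delta_\bowtie)=2$. Let $v_1,v_2$ be a basis of $\ker J_f^{N/\bowtie}$ and $v_1^*,v_2^*$ the basis of $(\operatorname{ran}J_f^{N/\bowtie})^\perp$ with $\langle v_i^*,v_j\rangle=\delta_{ij}$, assume that (H1a) holds for $f$ and $N/\bowtie$ (with these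 bases and $k=2$), and put $d_{ijl}=\langle v_i^*,v_j\ast v_l\rangle$, where $\ast$ is the coordinatewise product. (i) If $\bowtie$ is $\mu$-submaximal of type $1$ with $\mu$-simple component $\bowtie_1$, and the lift of $v_1$ to $N$ lies in $\Delta_{\bowtie_1}$, then there is a bifurcation branch of $f$ on $N$ with exactly synchrony $\bowtie$ if and only if $$(d_{222}-2d_{112})^2\ \ge\ 4\,d_{122}\,(d_{111}-2d_{212}).$$ (ii) If $\bowtie$ is $\mu$-submaximal of type $2$ with $\mu$-simple components $\bowtie_1,\bowtie_2$, and the lifts of $v_1$ and $v_2$ to $N$ lie in $\Delta_{\bowtie_1}$ and $\Delta_{\bowtie_2}$ respectively, then there is a bifurcation branch of $f$ on $N$ with exactly synchrony $\bowtie$ if and only if $$(2d_{212}-d_{111})(2d_{112}-d_{222})\neq0.$$ -/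

import Mathlib

open scoped ContDiff Topology

noncomputable section

/-- A regular network of valency `ϑ`: a directed multigraph with cells `C`, edges `E`, source and target
maps, in which every cell is the target of exactly `ϑ` edges. -/
structure RegularNetwork (C E : Type*) (ϑ : ℕ) where
  s : E → C
  t : E → C
  card_input : ∀ c : C, Nat.card {e : E // t e = c} = ϑ

instance quotientFintype {C : Type*} [Fintype C] (r : Setoid C) : Fintype (Quotient r) :=
  Fintype.ofFinite _

/-- The polydiagonal subspace `Δ_r` of a coloring `r`. Colorings are equivalence relations on the cells, and
`r ≤ r'` means that `r` refines `r'` (or is equal to it). -/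
def polydiagonal {C : Type*} (r : Setoid C) : Submodule ℝ (C → ℝ) where
  carrier := {x | ∀ c d, r c d → x c = x d}
  add_mem' := fun hx hy c d h => by simp [hx c d h, hy c d h]
  zero_mem' := fun _ _ _ => rfl
  smul_mem' := fun a x hx c d h => by simp [hx c d h]

namespace RegularNetwork

variable {C E : Type*} {ϑ : ℕ}

/-- A coloring is balanced if any two cells of the same color have input sets that are in bijection by a
map which preserves the color of the source cells. -/
def IsBalanced (N : RegularNetwork C E ϑ) (r : Setoid C) : Prop :=
  ∀ c d, r c d → ∃ φ : {e : E // N.t e = c} ≃ {e : E // N.t e = d},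
    ∀ e, r (N.s e.1) (N.s (φ e).1)

/-- The quotient network `N/r`: its cells are the color classes, and its edges into a class are the edges
of `N` into a representative of the class (for a balanced `r` the choice of the representative does not
matter, up to isomorphism). -/
def quotient (N : RegularNetwork C E ϑ) (r : Setoid C) :
    RegularNetwork (Quotient r) {e : E // ∃ q : Quotient r, N.t e = q.out} ϑ where
  s := fun e => Quotient.mk r (N.s e.1)
  t := fun e => Quotient.mk r (N.t e.1)
  card_input := fun q => by
    have h₁ : ∀ e : {e : E // ∃ q : Quotient r, N.t e = q.out},
        Quotient.mk r (N.t e.1) = q → N.t e.1 = q.out := by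
      rintro ⟨e, q', hq'⟩ he
      simp only [hq', Quotient.out_eq] at he
      simp [hq', he]
    have h₂ : ∀ e, N.t e = q.out → Quotient.mk r (N.t e) = q := by
      intro e he
      rw [he, Quotient.out_eq]
    exact (Nat.card_congr ⟨fun e => ⟨e.1.1, h₁ e.1 e.2⟩, fun e => ⟨⟨e.1, q, e.2⟩, h₂ e.1 e.2⟩,
      fun _ => rfl, fun _ => rfl⟩).trans (N.card_input q.out)

/-- The adjacency matrix: the entry at `(c, c')` is the number of edges from `c'` to `c`. -/
def adjacency (N : RegularNetwork C E ϑ) : Matrix C C ℝ :=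
  Matrix.of fun c c' => (Nat.card {e : E // N.s e = c' ∧ N.t e = c} : ℝ)

/-- An enumeration of the input set of a cell. As it is only used together with functions that are
symmetric in the inputs, the choice does not matter. -/
def enum [Finite E] (N : RegularNetwork C E ϑ) (c : C) : Fin ϑ ≃ {e : E // N.t e = c} :=
  (Finite.equivFinOfCardEq (N.card_input c)).symm

/-- The family of admissible vector fields `f^N(x, λ)_c = f(x_c, (x_{s(e)})_{e ∈ I(c)}, λ)`. -/
def field [Finite E] (N : RegularNetwork C E ϑ) (f : ℝ × (Fin ϑ → ℝ) × ℝ → ℝ)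
    (p : (C → ℝ) × ℝ) : C → ℝ :=
  fun c => f (p.1 c, fun i => p.1 (N.s (N.enum c i).1), p.2)

/-- The Jacobian `J_f^N` of `f^N(·, 0)` at the origin. -/
def jac [Fintype C] [Finite E] (N : RegularNetwork C E ϑ) (f : ℝ × (Fin ϑ → ℝ) × ℝ → ℝ) :
    (C → ℝ) →L[ℝ] (C → ℝ) :=
  fderiv ℝ (fun x => N.field f (x, 0)) 0

end RegularNetwork

section Eigenvalues

variable {C : Type*} [Fintype C]

/-- Geometric multiplicity of `μ` as an eigenvalue of `A` (it is `0` when `μ` is not an eigenvalue). -/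
def geomMult (A : Matrix C C ℝ) (μ : ℝ) : ℕ :=
  Module.finrank ℝ (Module.End.eigenspace A.mulVecLin μ)

/-- Algebraic multiplicity of `μ` as an eigenvalue of `A` (it is `0` when `μ` is not an eigenvalue). -/
def algMult (A : Matrix C C ℝ) (μ : ℝ) : ℕ :=
  A.mulVecLin.charpoly.rootMultiplicity μ

def IsSemisimpleEigenvalue (A : Matrix C C ℝ) (μ : ℝ) : Prop :=
  Module.End.HasEigenvalue A.mulVecLin μ ∧ algMult A μ = geomMult A μ

end Eigenvalues

/-- `r` is a `μ`-submaximal coloring of type `j`, and `comp 0, …, comp (j - 1)` are its `μ`-simple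
components. -/
def IsSubmaximal {C E : Type*} {ϑ : ℕ} [Fintype C] (N : RegularNetwork C E ϑ) (μ : ℝ)
    (r : Setoid C) (j : ℕ) (comp : Fin j → Setoid C) : Prop :=
  1 < algMult N.adjacency μ ∧ N.IsBalanced r ∧ Function.Injective comp ∧
  (∀ i, N.IsBalanced (comp i) ∧ r < comp i ∧ algMult (N.quotient (comp i)).adjacency μ = 1) ∧
  (∀ i i', i ≠ i' → ¬ comp i ≤ comp i') ∧
  (∀ r' : Setoid C, N.IsBalanced r' → r < r' → (∀ i, r' ≠ comp i) →
    ¬ Module.End.HasEigenvalue (N.quotient r').adjacency.mulVecLin μ ∨ ∃ i, comp i ≤ r')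

section Functions

variable {ϑ : ℕ}

/-- `∂f/∂x₀` at `(0, …, 0, λ)`. -/
def dSelf (f : ℝ × (Fin ϑ → ℝ) × ℝ → ℝ) (l : ℝ) : ℝ :=
  fderiv ℝ f (0, 0, l) (1, 0, 0)

/-- `∂f/∂x₁` at `(0, …, 0, λ)`; it is `0` if there are no inputs. -/
def dInput (f : ℝ × (Fin ϑ → ℝ) × ℝ → ℝ) (l : ℝ) : ℝ :=
  if h : 0 < ϑ then fderiv ℝ f (0, 0, l) (0, Pi.single ⟨0, h⟩ 1, 0) else 0

/-- `f_{0λ} + μ f_{1λ}`. -/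
def crossing (μ : ℝ) (f : ℝ × (Fin ϑ → ℝ) × ℝ → ℝ) : ℝ :=
  deriv (dSelf f) 0 + μ * deriv (dInput f) 0

/-- The functions `f(x₀, x₁, …, x_ϑ, λ)` that are smooth near the origin, symmetric in `x₁, …, x_ϑ`,
vanish at `(0, …, 0, λ)` for every `λ`, and satisfy the bifurcation condition `f₀ + μ f₁ = 0`. -/
def bifClass (ϑ : ℕ) (μ : ℝ) : Set (ℝ × (Fin ϑ → ℝ) × ℝ → ℝ) :=
  {f | (∃ U ∈ 𝓝 (0 : ℝ × (Fin ϑ → ℝ) × ℝ), ContDiffOn ℝ ∞ f U) ∧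
    (∀ (σ : Equiv.Perm (Fin ϑ)) x₀ x l, f (x₀, x ∘ σ, l) = f (x₀, x, l)) ∧
    (∀ l, f (0, 0, l) = 0) ∧
    dSelf f 0 + μ * dInput f 0 = 0}

/-- `P` holds for generic `f` in `bifClass ϑ μ`: it holds on an open dense subset `G`. Openness is asked
for the topology of some finite-order Taylor jet at the origin (so that `G` is also open for every finer
topology), and density for smooth perturbations that are arbitrarily small on arbitrarily large balls
together with arbitrarily many derivatives. -/
def Generically (ϑ : ℕ) (μ : ℝ) (P : (ℝ × (Fin ϑ → ℝ) × ℝ → ℝ) → Prop) : Prop :=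
  ∃ G ⊆ bifClass ϑ μ,
    (∀ f ∈ G, ∃ n : ℕ, ∃ ε > 0, ∀ f' ∈ bifClass ϑ μ,
      (∀ i ≤ n, ‖iteratedFDeriv ℝ i (f' - f) 0‖ < ε) → f' ∈ G) ∧
    (∀ f ∈ bifClass ϑ μ, ∀ (n : ℕ) (R : ℝ), ∀ ε > 0, ∃ f' ∈ G, ContDiff ℝ ∞ (f' - f) ∧
      ∀ i ≤ n, ∀ x, ‖x‖ ≤ R → ‖iteratedFDeriv ℝ i (f' - f) x‖ < ε) ∧
    ∀ f ∈ G, P f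

end Functions

section Reduction

variable {C E : Type*} {ϑ m : ℕ} [Fintype C] [Finite E]

/-- `v` is a basis of `ker J_f^N` and `w` is the basis of `(ran J_f^N)^⊥` with `⟨w i, v j⟩ = δ_{ij}`. -/
def IsReductionBasis (N : RegularNetwork C E ϑ) (f : ℝ × (Fin ϑ → ℝ) × ℝ → ℝ)
    (v w : Fin m → C → ℝ) : Prop :=
  LinearIndependent ℝ v ∧ (∀ x, x ∈ Submodule.span ℝ (Set.range v) ↔ N.jac f x = 0) ∧
  LinearIndependent ℝ w ∧
  (∀ x, x ∈ Submodule.span ℝ (Set.range w) ↔ ∀ z, x ⬝ᵥ N.jac f z = 0) ∧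
  ∀ i j, w i ⬝ᵥ v j = if i = j then 1 else 0

/-- `g` is (a representative near the origin of) the Lyapunov–Schmidt reduction of `f^N(x, λ) = 0`, in the
coordinates given by `v` and `w`: with `W(y, λ) ∈ (ker J)^⊥` the smooth solution, `W(0, 0) = 0`, of
`f^N(∑ y_i v_i + W(y, λ), λ) ∈ (ran J)^⊥`, it is `g_i(y, λ) = ⟨w_i, f^N(∑ y_i v_i + W(y, λ), λ)⟩`. -/
def IsReduction (N : RegularNetwork C E ϑ) (f : ℝ × (Fin ϑ → ℝ) × ℝ → ℝ)
    (v w : Fin m → C → ℝ) (g : (Fin m → ℝ) × ℝ → (Fin m → ℝ)) : Prop :=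
  ∃ W : (Fin m → ℝ) × ℝ → (C → ℝ), ContDiffAt ℝ ∞ W 0 ∧ W 0 = 0 ∧
    ∀ᶠ p in 𝓝 (0 : (Fin m → ℝ) × ℝ),
      (∀ x, N.jac f x = 0 → x ⬝ᵥ W p = 0) ∧
      (∀ z, N.jac f z ⬝ᵥ N.field f (∑ i, p.1 i • v i + W p, p.2) = 0) ∧
      (∀ i, g p i = w i ⬝ᵥ N.field f (∑ i, p.1 i • v i + W p, p.2))

/-- `k(N, f) = k`: the Taylor expansion at the origin of the reduced function `g(·, 0)` starts with terms
of degree exactly `k`. -/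
def HasOrder (N : RegularNetwork C E ϑ) (f : ℝ × (Fin ϑ → ℝ) × ℝ → ℝ) (k : ℕ) : Prop :=
  ∃ (m : ℕ) (v w : Fin m → C → ℝ) (g : (Fin m → ℝ) × ℝ → (Fin m → ℝ)),
    IsReductionBasis N f v w ∧ IsReduction N f v w g ∧
    (∀ i < k, iteratedFDeriv ℝ i (fun y => g (y, 0)) 0 = 0) ∧
    iteratedFDeriv ℝ k (fun y => g (y, 0)) 0 ≠ 0

/-- `k(N, μ) = k`: generically `k(N, f) = k`. -/
def HasGenericOrder (N : RegularNetwork C E ϑ) (μ : ℝ) (k : ℕ) : Prop :=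
  Generically ϑ μ fun f => HasOrder N f k

/-- The homogeneous Taylor polynomial `Q_k` of degree `k` of `g(·, 0)` at the origin. -/
def taylorForm (k : ℕ) (g : (Fin m → ℝ) × ℝ → (Fin m → ℝ)) (u : Fin m → ℝ) : Fin m → ℝ :=
  (k.factorial : ℝ)⁻¹ • iteratedFDeriv ℝ k (fun y => g (y, 0)) 0 fun _ => u

/-- The blown-up map at `ε = 0`: `h(u, 0, η) = η a u + Q(u)`, with `a = f_{0λ} + μ f_{1λ}`. -/
def blowUp (a : ℝ) (Q : (Fin m → ℝ) → (Fin m → ℝ)) (p : (Fin m → ℝ) × ℝ) : Fin m → ℝ :=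
  (p.2 * a) • p.1 + Q p.1

/-- `η̃(u) = - ⟨Q(u), u⟩ / a`. -/
def etaTilde (a : ℝ) (Q : (Fin m → ℝ) → (Fin m → ℝ)) (u : Fin m → ℝ) : ℝ :=
  -(Q u ⬝ᵥ u) / a

/-- The vector field `h̃(u) = h(u, 0, η̃(u))` on the unit sphere. -/
def hTilde (a : ℝ) (Q : (Fin m → ℝ) → (Fin m → ℝ)) (u : Fin m → ℝ) : Fin m → ℝ :=
  blowUp a Q (u, etaTilde a Q u)

/-- The derivative of `h(·, 0, ·)` at `(u, η̃(u))` is non-singular on `T_u S^{m-1} × ℝ`. -/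
def IsNondegenerateZero (a : ℝ) (Q : (Fin m → ℝ) → (Fin m → ℝ)) (u : Fin m → ℝ) : Prop :=
  ∀ (τ : Fin m → ℝ) (s : ℝ), τ ⬝ᵥ u = 0 →
    fderiv ℝ (blowUp a Q) (u, etaTilde a Q u) (τ, s) = 0 → τ = 0 ∧ s = 0

/-- Condition (H1a) for `f` and `N`: for every zero `u` of `h̃` on the unit sphere and every balanced
coloring `r`, other than the one into singletons, such that `∑ u_i v_i` is not in `Δ_r`, the zero `u` is
nondegenerate. -/
def CondH1a (N : RegularNetwork C E ϑ) (μ : ℝ) (k : ℕ) (f : ℝ × (Fin ϑ → ℝ) × ℝ → ℝ)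
    (v w : Fin m → C → ℝ) : Prop :=
  ∃ g : (Fin m → ℝ) × ℝ → (Fin m → ℝ), IsReduction N f v w g ∧
    ∀ (u : Fin m → ℝ) (r : Setoid C), u ⬝ᵥ u = 1 →
      hTilde (crossing μ f) (taylorForm k g) u = 0 → N.IsBalanced r → ⊥ < r →
      ∑ i, u i • v i ∉ polydiagonal r →
      IsNondegenerateZero (crossing μ f) (taylorForm k g) u

/-- The origin is an isolated zero of `f^N(·, 0)`. -/
def IsolatedOrigin (N : RegularNetwork C E ϑ) (f : ℝ × (Fin ϑ → ℝ) × ℝ → ℝ) : Prop :=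
  ∀ᶠ x in 𝓝[≠] (0 : C → ℝ), N.field f (x, 0) ≠ 0

/-- `b : [0, δ[ → ℝ^N × ℝ` is a bifurcation branch of `f` on `N`. -/
def IsBifurcationBranch (N : RegularNetwork C E ϑ) (f : ℝ × (Fin ϑ → ℝ) × ℝ → ℝ)
    (δ : ℝ) (b : ℝ → (C → ℝ) × ℝ) : Prop :=
  0 < δ ∧ DifferentiableOn ℝ b (Set.Ico 0 δ) ∧ b 0 = 0 ∧
    ∀ z ∈ Set.Ioo 0 δ, (b z).2 ≠ 0 ∧ N.field f (b z) = 0 ∧ (b z).1 ≠ 0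

/-- The germ at `0` of the branch `b` has exactly synchrony `r`: the branch lies in `Δ_r`, and no initial
piece of it lies in `Δ_{r'}` for a balanced coloring `r'` that is strictly coarser than `r`. -/
def HasExactSynchrony (N : RegularNetwork C E ϑ) (r : Setoid C)
    (δ : ℝ) (b : ℝ → (C → ℝ) × ℝ) : Prop :=
  (∀ z ∈ Set.Ico 0 δ, (b z).1 ∈ polydiagonal r) ∧
    ∀ r', N.IsBalanced r' → r < r' → ∀ δ' ∈ Set.Ioc 0 δ,
      ∃ z ∈ Set.Ico 0 δ', (b z).1 ∉ polydiagonal r'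

/-- There is a bifurcation branch of `f` on `N` with exactly synchrony `r`. -/
def SupportsBranch (N : RegularNetwork C E ϑ) (f : ℝ × (Fin ϑ → ℝ) × ℝ → ℝ)
    (r : Setoid C) : Prop :=
  ∃ (δ : ℝ) (b : ℝ → (C → ℝ) × ℝ), IsBifurcationBranch N f δ b ∧ HasExactSynchrony N r δ b

end Reduction

/-- The lift to `N` of a vector `x` on the cells of `N/r`. -/
def liftVec {C : Type*} {r : Setoid C} (x : Quotient r → ℝ) : C → ℝ :=
  fun c => x (Quotient.mk r c)

/-- `d_{ijl} = ⟨w_i, v_j ∗ v_l⟩` with the coordinatewise product `∗` (indices start at `0`). -/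
def dCoef {C : Type*} [Fintype C] {m : ℕ} (v w : Fin m → C → ℝ) (i j l : Fin m) : ℝ :=
  w i ⬝ᵥ (v j * v l)

end

/-!
The Lyapunov–Schmidt reduction `g` of the quotient field at the origin has vanishing first jet. On
kernel vectors, which are eigenvectors of the adjacency matrix, the Hessian of the field only depends
on the coordinatewise product (`exists_hessian_eigenvectors`, from the symmetry of `f` in its inputs).
Hence the quadratic part of `g` is `λ a y + Q(y)` with `Q_i(y) = (b / 2) ∑ d_{ijl} y_j y_l` for one
number `b`, nonzero because the order is two.

*Existence.* A direction `u` with `Q(u)` parallel to `u` is a zero of the blown-up map. If it is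
nondegenerate, the implicit function theorem, applied to the `C¹` extension of `ε⁻² g(ε y, ε η)`
across `ε = 0`, gives a curve of zeros (`exists_zero_curve`, `exists_branch_of_nondegenerate`). Its
parameter does not vanish because the origin is isolated for `λ = 0`. Its synchrony is read off from
its direction: a strictly coarser balanced coloring either has no eigenvalue `μ`, or its polydiagonal
lies in that of a `μ`-simple component (`supportsBranch_of_zero_direction`).

*Nonexistence.* If zeros of the field accumulate at the origin outside the polydiagonal `Δ` of a
`μ`-simple component, their limit directions are zeros of the blown-up map. If such a limit lies in
`Δ`, expanding the field relative to the projection of the zeros to `Δ` gives a transversal kernel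
vector of the derivative of the blown-up map (`exists_limit_direction`). So that zero is degenerate.

*The plane.* For a kernel of dimension two, `u ∧ Q(u)` is a binary cubic form in `u₀, u₁`. For type
one, `d_{100} = 0`, so it is `u₁` times a quadratic form, whose discriminant is the stated one. The
zero `u₁ = 0` is always nondegenerate: by (H1a) for the coloring with a single color, or by
computation when `v₀` is constant. For type two, `d_{100} = d_{011} = 0`, so the form is `u₀ u₁` times
a linear form with the coefficients `2 d_{101} - d_{000}` and `d_{111} - 2 d_{001}`. Condition (H1a) for the two
components makes both coefficients nonzero, so the product in the statement does not vanish and the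
linear form provides a direction that lies in neither polydiagonal.
-/

/-! ### Blow-up of a map with vanishing first jet -/

section Analysis

open MeasureTheory

variable {E F : Type*} [NormedAddCommGroup E] [NormedSpace ℝ E] [NormedAddCommGroup F]
  [NormedSpace ℝ F]

lemma hasFDerivAt_half_quadratic (D : E →L[ℝ] E →L[ℝ] F) (hsymm : ∀ X Y, D X Y = D Y X) (Z : E) :
    HasFDerivAt (fun Y => (2⁻¹ : ℝ) • D Y Y) (D Z) Z := by
  have hq : HasFDerivAt (fun Y => D Y Y) (D Z ∘L .id ℝ E + D.flip Z) Z :=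
    (D.hasFDerivAt (x := Z)).clm_apply (hasFDerivAt_id (𝕜 := ℝ) Z)
  have := hq.const_smul (2⁻¹ : ℝ)
  refine this.congr_fderiv ?_
  ext W
  change (2⁻¹ : ℝ) • (D Z W + D W Z) = D Z W
  rw [hsymm W Z, ← two_smul ℝ, smul_smul]
  norm_num

lemma contDiff_one_intervalIntegral [FiniteDimensional ℝ E] {φ : ℝ × E → F}
    (h : ContDiff ℝ 1 φ) : ContDiff ℝ 1 (fun x => ∫ t in (0 : ℝ)..1, φ (t, x)) := by
  have hc : Continuous φ := h.continuous
  have hc' : Continuous (fun p : ℝ × E => (fderiv ℝ φ p).comp (ContinuousLinearMap.inr ℝ ℝ E)) :=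
    (h.continuous_fderiv one_ne_zero).clm_comp continuous_const
  have key : ∀ x₀ : E, HasFDerivAt (fun x => ∫ t in (0 : ℝ)..1, φ (t, x))
      (∫ t in (0 : ℝ)..1, (fderiv ℝ φ (t, x₀)).comp (ContinuousLinearMap.inr ℝ ℝ E)) x₀ := by
    intro x₀
    obtain ⟨M, hM⟩ := ((isCompact_Icc (a := (0 : ℝ)) (b := 1)).prod
      (isCompact_closedBall x₀ 1)).exists_bound_of_continuousOn hc'.continuousOn
    refine intervalIntegral.hasFDerivAt_integral_of_dominated_of_fderiv_le
      (F := fun x t => φ (t, x))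
      (F' := fun x t => (fderiv ℝ φ (t, x)).comp (ContinuousLinearMap.inr ℝ ℝ E))
      (bound := fun _ => M)
      (Metric.closedBall_mem_nhds x₀ one_pos) ?_ ?_ ?_ ?_ ?_ ?_
    · refine Filter.Eventually.of_forall fun x => ?_
      exact (hc.comp (by fun_prop : Continuous fun t : ℝ => (t, x))).aestronglyMeasurable
    · exact (hc.comp (by fun_prop : Continuous fun t : ℝ => (t, x₀))).intervalIntegrable _ _
    · exact (hc'.comp (by fun_prop : Continuous fun t : ℝ => (t, x₀))).aestronglyMeasurable
    · refine Filter.Eventually.of_forall fun t ht x hx => hM (t, x) ⟨?_, hx⟩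
      rw [Set.uIoc_of_le zero_le_one] at ht
      exact ⟨ht.1.le, ht.2⟩
    · exact intervalIntegrable_const
    · refine Filter.Eventually.of_forall fun t _ x _ => ?_
      have h1 : HasFDerivAt φ (fderiv ℝ φ (t, x)) (t, x) :=
        (h.differentiable one_ne_zero _).hasFDerivAt
      exact h1.comp x (hasFDerivAt_prodMk_right t x)
  rw [contDiff_one_iff_fderiv]
  refine ⟨fun x => (key x).differentiableAt, ?_⟩
  have : fderiv ℝ (fun x => ∫ t in (0 : ℝ)..1, φ (t, x)) = fun x =>
      ∫ t in (0 : ℝ)..1, (fderiv ℝ φ (t, x)).comp (ContinuousLinearMap.inr ℝ ℝ E) :=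
    funext fun x => (key x).fderiv
  rw [this]
  exact intervalIntegral.continuous_parametric_intervalIntegral_of_continuous'
    (f := fun x t => (fderiv ℝ φ (t, x)).comp (ContinuousLinearMap.inr ℝ ℝ E))
    (hc'.comp (by fun_prop : Continuous fun p : E × ℝ => (p.2, p.1))) 0 1

/-- A germ of a smooth map extends to a globally smooth map, by a cut-off. -/
lemma exists_contDiff_eventuallyEq [FiniteDimensional ℝ E] {g : E → F} {x₀ : E} {n : ℕ}
    (hg : ContDiffAt ℝ n g x₀) : ∃ G : E → F, ContDiff ℝ n G ∧ G =ᶠ[𝓝 x₀] g := by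
  obtain ⟨r, hr, hU⟩ := Metric.eventually_nhds_iff_ball.1 (hg.eventually (by simp))
  let b : ContDiffBump x₀ := ⟨r / 4, r / 2, by positivity, by linarith⟩
  refine ⟨fun x => b x • g x, contDiff_iff_contDiffAt.2 fun x => ?_, ?_⟩
  · by_cases hx : x ∈ Metric.ball x₀ r
    · exact b.contDiff.contDiffAt.smul (hU x hx)
    · have hx' : x ∉ tsupport b := by
        rw [b.tsupport_eq]
        intro h
        apply hx
        rw [Metric.mem_closedBall] at h
        have : b.rOut = r / 2 := rfl
        rw [Metric.mem_ball]
        linarith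
      have h0 : (fun x => b x • g x) =ᶠ[𝓝 x] fun _ => 0 := by
        filter_upwards [notMem_tsupport_iff_eventuallyEq.1 hx'] with y hy
        simp [hy]
      exact contDiffAt_const.congr_of_eventuallyEq h0
  · filter_upwards [b.eventuallyEq_one] with x hx
    simp [hx]

/-- If the first jet of `g` vanishes at the origin, then `(ε, Y) ↦ ε⁻² g(ε Y)` extends to a map of
class `C¹` across `ε = 0`, by half the Hessian; the extension is the remainder integral of Taylor's
formula. -/
lemma exists_blowUp_contDiff [FiniteDimensional ℝ E] {g : E → F} [CompleteSpace F]
    (hg : ContDiffAt ℝ 3 g 0) (h0 : g 0 = 0) (h1 : fderiv ℝ g 0 = 0) :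
    ∃ k : ℝ × E → F, ContDiff ℝ 1 k ∧
      (∀ Y, k (0, Y) = (2⁻¹ : ℝ) • fderiv ℝ (fderiv ℝ g) 0 Y Y) ∧
      ∀ᶠ X in 𝓝 (0 : E), ∀ (ε : ℝ) (Y : E), X = ε • Y → g X = ε ^ 2 • k (ε, Y) := by
  obtain ⟨G, hG, hGg⟩ := exists_contDiff_eventuallyEq (n := 3) hg
  have hGg1 : fderiv ℝ G =ᶠ[𝓝 0] fderiv ℝ g := hGg.fderiv
  have hGg2 : fderiv ℝ (fderiv ℝ G) 0 = fderiv ℝ (fderiv ℝ g) 0 := hGg1.fderiv_eq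
  have hD : ContDiff ℝ 1 (fderiv ℝ (fderiv ℝ G)) :=
    (hG.fderiv_right (m := 2) (by norm_num)).fderiv_right (by norm_num)
  refine ⟨fun p => ∫ t in (0 : ℝ)..1,
    (1 - t) • fderiv ℝ (fderiv ℝ G) ((t * p.1) • p.2) p.2 p.2, ?_, ?_, ?_⟩
  · refine contDiff_one_intervalIntegral (φ := fun q : ℝ × (ℝ × E) =>
      (1 - q.1) • fderiv ℝ (fderiv ℝ G) ((q.1 * q.2.1) • q.2.2) q.2.2 q.2.2) ?_
    have : ContDiff ℝ 1 fun q : ℝ × (ℝ × E) => fderiv ℝ (fderiv ℝ G) ((q.1 * q.2.1) • q.2.2) :=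
      hD.comp (by fun_prop)
    fun_prop
  · intro Y
    simp only [mul_zero, zero_smul, hGg2]
    rw [intervalIntegral.integral_smul_const]
    congr 1
    rw [intervalIntegral.integral_sub (by simp) (by simp)]
    simp
    norm_num
  · filter_upwards [hGg] with X hX ε Y hXY
    have hT := map_add_eq_sum_add_integral_iteratedFDeriv (f := G) (n := 1) (x := 0) (y := X)
      (fun t _ => (hG.of_le (by norm_num)).contDiffAt)
    rw [zero_add, hX] at hT
    rw [hT, Finset.sum_range_succ, Finset.sum_range_one]
    simp only [iteratedFDeriv_zero_apply, iteratedFDeriv_one_apply, hGg.self_of_nhds, h0,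
      hGg1.self_of_nhds, h1, zero_apply, smul_zero, zero_add, pow_one, Nat.factorial_one,
      Nat.cast_one, inv_one, one_smul]
    rw [← intervalIntegral.integral_smul]
    refine intervalIntegral.integral_congr fun t _ => ?_
    simp only [Nat.reduceAdd, iteratedFDeriv_two_apply, hXY, smul_smul, map_smul, smul_apply]
    congr 1
    ring

/-- A simple zero of the quadratic part of `g`, on the affine hyperplane `ℓ = 1`, is the direction
of a curve of zeros of `g`. -/
lemma exists_zero_curve [FiniteDimensional ℝ E] [FiniteDimensional ℝ F] {g : E → F}
    (hg : ContDiffAt ℝ 3 g 0) (h0 : g 0 = 0) (h1 : fderiv ℝ g 0 = 0)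
    (hdim : Module.finrank ℝ E = Module.finrank ℝ F + 1) (ℓ : E →L[ℝ] ℝ) (Y₀ : E)
    (hℓ : ℓ Y₀ = 1) (hz : fderiv ℝ (fderiv ℝ g) 0 Y₀ Y₀ = 0)
    (hnd : ∀ Y, ℓ Y = 0 → fderiv ℝ (fderiv ℝ g) 0 Y₀ Y = 0 → Y = 0) :
    ∃ φ : ℝ → E, ContDiffAt ℝ 1 φ 0 ∧ φ 0 = Y₀ ∧ ∀ᶠ ε in 𝓝 (0 : ℝ), g (ε • φ ε) = 0 := by
  have : CompleteSpace F := FiniteDimensional.complete ℝ F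
  have : CompleteSpace E := FiniteDimensional.complete ℝ E
  obtain ⟨k, hk, hk0, hkg⟩ := exists_blowUp_contDiff hg h0 h1
  set D := fderiv ℝ (fderiv ℝ g) 0 with hDdef
  have hsymm : ∀ X Y, D X Y = D Y X := by
    intro X Y
    exact (hg.isSymmSndFDerivAt (by simp; norm_num)) X Y
  -- the blown-up equation, with the scaling of `Y` fixed by `ℓ`
  let Φ : ℝ × E → F × ℝ := fun p => (k p, ℓ p.2 - 1)
  have hΦ : ContDiffAt ℝ 1 Φ (0, Y₀) := by
    have : ContDiff ℝ 1 Φ := hk.prodMk (by fun_prop)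
    exact this.contDiffAt
  have hΦ0 : Φ (0, Y₀) = 0 := by simp [Φ, hk0, hz, hℓ]
  have hder : ∀ Y, (fderiv ℝ Φ (0, Y₀) ∘L .inr ℝ ℝ E) Y = (D Y₀ Y, ℓ Y) := by
    have hA : HasFDerivAt (fun Y => Φ (0, Y)) (fderiv ℝ Φ (0, Y₀) ∘L .inr ℝ ℝ E) Y₀ :=
      (hΦ.differentiableAt one_ne_zero).hasFDerivAt.comp Y₀ (hasFDerivAt_prodMk_right 0 Y₀)
    have hB : HasFDerivAt (fun Y => Φ (0, Y))
        ((D Y₀).prod ℓ) Y₀ := by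
      have := (hasFDerivAt_half_quadratic D hsymm Y₀).prodMk (ℓ.hasFDerivAt.sub_const (1 : ℝ))
      refine this.congr_of_eventuallyEq (Filter.Eventually.of_forall fun Y => ?_)
      simp [Φ, hk0]
    intro Y
    rw [hA.unique hB]
    rfl
  have hinv : (fderiv ℝ Φ (0, Y₀) ∘L .inr ℝ ℝ E).IsInvertible := by
    set T := fderiv ℝ Φ (0, Y₀) ∘L .inr ℝ ℝ E with hT
    have hinj : Function.Injective T.toLinearMap := by
      rw [← LinearMap.ker_eq_bot, LinearMap.ker_eq_bot']
      intro Y hY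
      have hY' : (D Y₀ Y, ℓ Y) = 0 := (hder Y).symm.trans hY
      exact hnd Y (congrArg Prod.snd hY') (congrArg Prod.fst hY')
    have hd : Module.finrank ℝ E = Module.finrank ℝ (F × ℝ) := by simp [hdim]
    refine ⟨(LinearEquiv.ofInjectiveOfFinrankEq T.toLinearMap hinj hd).toContinuousLinearEquiv, ?_⟩
    ext Y <;> rfl
  refine ⟨hΦ.implicitFunction one_ne_zero hinv, hΦ.contDiffAt_implicitFunction one_ne_zero hinv,
    hΦ.implicitFunction_apply_self one_ne_zero hinv, ?_⟩
  have hcont : Filter.Tendsto (fun ε : ℝ => ε • hΦ.implicitFunction one_ne_zero hinv ε) (𝓝 0)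
      (𝓝 0) := by
    have := (hΦ.contDiffAt_implicitFunction one_ne_zero hinv).continuousAt
    have h2 : ContinuousAt (fun ε : ℝ => ε • hΦ.implicitFunction one_ne_zero hinv ε) 0 :=
      continuousAt_id.smul this
    simpa [ContinuousAt] using h2
  filter_upwards [hΦ.eventually_apply_implicitFunction one_ne_zero hinv, hcont.eventually hkg]
    with ε h1 h2
  rw [h2 ε _ rfl]
  rw [hΦ0] at h1
  have : k (ε, hΦ.implicitFunction one_ne_zero hinv ε) = 0 := congrArg Prod.fst h1
  rw [this, smul_zero]

/-- The remainder of the second order Taylor expansion has a Lipschitz constant that is small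
compared with the distance to the origin. -/
lemma taylor_two_remainder {g : E → F} (hg : ContDiffAt ℝ 2 g 0) {c : ℝ} (hc : 0 < c) :
    ∃ δ > 0, ∀ R < δ, ∀ X Y : E, ‖X‖ ≤ R → ‖Y‖ ≤ R →
      ‖(g X - fderiv ℝ g 0 X - (2⁻¹ : ℝ) • fderiv ℝ (fderiv ℝ g) 0 X X) -
        (g Y - fderiv ℝ g 0 Y - (2⁻¹ : ℝ) • fderiv ℝ (fderiv ℝ g) 0 Y Y)‖ ≤ c * R * ‖X - Y‖ := by
  set D := fderiv ℝ (fderiv ℝ g) 0 with hD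
  have hsymm : ∀ X Y, D X Y = D Y X := fun X Y => (hg.isSymmSndFDerivAt (by simp)) X Y
  have hdiff : HasFDerivAt (fderiv ℝ g) D 0 :=
    ((hg.fderiv_right (m := 1) (by norm_num)).differentiableAt one_ne_zero).hasFDerivAt
  have h1 : ∀ᶠ X in 𝓝 (0 : E), DifferentiableAt ℝ g X :=
    (hg.eventually (by simp)).mono fun X hX => hX.differentiableAt two_ne_zero
  have h2 := hdiff.isLittleO.def hc
  obtain ⟨δ, hδ, hball⟩ := Metric.eventually_nhds_iff_ball.1 (h1.and h2)
  refine ⟨δ, hδ, fun R hR X Y hX hY => ?_⟩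
  have hRD : ∀ Z ∈ Metric.closedBall (0 : E) R, HasFDerivWithinAt
      (fun Z => g Z - fderiv ℝ g 0 Z - (2⁻¹ : ℝ) • D Z Z)
      (fderiv ℝ g Z - fderiv ℝ g 0 - D Z) (Metric.closedBall (0 : E) R) Z := by
    intro Z hZ
    have hZ' : Z ∈ Metric.ball (0 : E) δ := by
      rw [Metric.mem_ball]; exact (Metric.mem_closedBall.1 hZ).trans_lt hR
    exact (((hball Z hZ').1.hasFDerivAt.sub (fderiv ℝ g 0).hasFDerivAt).sub
      (hasFDerivAt_half_quadratic D hsymm Z)).hasFDerivWithinAt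
  refine (convex_closedBall (0 : E) R).norm_image_sub_le_of_norm_hasFDerivWithin_le hRD ?_
    (by simpa using hY) (by simpa using hX)
  intro Z hZ
  have hZn : ‖Z‖ ≤ R := by simpa using hZ
  have hZ' : Z ∈ Metric.ball (0 : E) δ := by
    rw [Metric.mem_ball]; exact (Metric.mem_closedBall.1 hZ).trans_lt hR
  have := (hball Z hZ').2
  simp only [sub_zero] at this
  exact this.trans (by gcongr)

end Analysis

/-! ### Quotient networks and their adjacency matrices -/

section Networks

variable {C E C' E' : Type*} {ϑ : ℕ}

lemma polydiagonal_anti {r r' : Setoid C} (h : r ≤ r') {x : C → ℝ} (hx : x ∈ polydiagonal r') :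
    x ∈ polydiagonal r := fun c d hcd => hx c d (h hcd)

/-- `liftVec` as a linear map. -/
def liftLin (r : Setoid C) : (Quotient r → ℝ) →ₗ[ℝ] (C → ℝ) where
  toFun := liftVec
  map_add' _ _ := rfl
  map_smul' _ _ := rfl

lemma liftVec_injective {r : Setoid C} : Function.Injective (liftLin r) := by
  intro x y h
  ext q
  induction q using Quotient.inductionOn with
  | h c => exact congrFun h c

lemma liftVec_mem_polydiagonal {r : Setoid C} (x : Quotient r → ℝ) :
    liftVec x ∈ polydiagonal r := fun c d h => by
  unfold liftVec
  rw [Quotient.sound h]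

lemma exists_eq_liftVec {r : Setoid C} {x : C → ℝ} (hx : x ∈ polydiagonal r) :
    ∃ y : Quotient r → ℝ, liftVec y = x :=
  ⟨Quotient.lift x hx, rfl⟩

/-- Cells whose input sets correspond, with the same states of the sources, evolve equally. -/
lemma field_apply_eq [Finite E] [Finite E'] (N : RegularNetwork C E ϑ)
    (M : RegularNetwork C' E' ϑ) {f : ℝ × (Fin ϑ → ℝ) × ℝ → ℝ}
    (hf : ∀ (σ : Equiv.Perm (Fin ϑ)) x₀ x l, f (x₀, x ∘ σ, l) = f (x₀, x, l))
    {c : C} {c' : C'} (φ : {e : E // N.t e = c} ≃ {e : E' // M.t e = c'}) {x : C → ℝ}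
    {x' : C' → ℝ} (hx : x c = x' c') (hφ : ∀ e, x (N.s e.1) = x' (M.s (φ e).1)) (l : ℝ) :
    N.field f (x, l) c = M.field f (x', l) c' := by
  simp only [RegularNetwork.field]
  rw [hx, ← hf ((N.enum c).trans (φ.trans (M.enum c').symm)) (x' c')
    (fun i => x' (M.s (M.enum c' i).1)) l]
  congr 3
  ext i
  simp [hφ]

lemma exists_input_equiv_quotient (N : RegularNetwork C E ϑ) (r : Setoid C) (q : Quotient r) :
    ∃ φ : {e // (N.quotient r).t e = q} ≃ {e : E // N.t e = q.out},
      ∀ e, (N.quotient r).s e.1 = Quotient.mk r (N.s (φ e).1) := by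
  have h₁ : ∀ e : {e : E // ∃ q : Quotient r, N.t e = q.out},
      (N.quotient r).t e = q → N.t e.1 = q.out := by
    rintro ⟨e, q', hq'⟩ he
    change Quotient.mk r (N.t e) = q at he
    simp only [hq', Quotient.out_eq] at he
    simp [hq', he]
  have h₂ : ∀ e, N.t e = q.out → Quotient.mk r (N.t e) = q := by
    intro e he
    rw [he, Quotient.out_eq]
  exact ⟨⟨fun e => ⟨e.1.1, h₁ e.1 e.2⟩, fun e => ⟨⟨e.1, q, e.2⟩, h₂ e.1 e.2⟩,
    fun _ => rfl, fun _ => rfl⟩, fun _ => rfl⟩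

lemma field_liftVec [Finite E] {N : RegularNetwork C E ϑ} {r : Setoid C} (hr : N.IsBalanced r)
    {f : ℝ × (Fin ϑ → ℝ) × ℝ → ℝ}
    (hf : ∀ (σ : Equiv.Perm (Fin ϑ)) x₀ x l, f (x₀, x ∘ σ, l) = f (x₀, x, l))
    (x : Quotient r → ℝ) (l : ℝ) :
    N.field f (liftVec x, l) = liftVec ((N.quotient r).field f (x, l)) := by
  ext c
  obtain ⟨φ, hφ⟩ := hr c (Quotient.mk r c).out
    (Setoid.symm (Quotient.exact (Quotient.out_eq (Quotient.mk r c))))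
  obtain ⟨ψ, hψ⟩ := exists_input_equiv_quotient N r (Quotient.mk r c)
  refine field_apply_eq N (N.quotient r) hf (φ.trans ψ.symm) rfl (fun e => ?_) l
  rw [hψ]
  simp only [Equiv.trans_apply, Equiv.apply_symm_apply]
  exact congrArg x (Quotient.sound (hφ e))

lemma field_mem_polydiagonal [Finite E] {N : RegularNetwork C E ϑ} {r : Setoid C}
    (hr : N.IsBalanced r) {f : ℝ × (Fin ϑ → ℝ) × ℝ → ℝ}
    (hf : ∀ (σ : Equiv.Perm (Fin ϑ)) x₀ x l, f (x₀, x ∘ σ, l) = f (x₀, x, l))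
    {x : C → ℝ} (hx : x ∈ polydiagonal r) (l : ℝ) : N.field f (x, l) ∈ polydiagonal r := by
  obtain ⟨y, rfl⟩ := exists_eq_liftVec hx
  rw [field_liftVec hr hf]
  exact liftVec_mem_polydiagonal _

lemma sum_inputs [Fintype C] [Finite E] (N : RegularNetwork C E ϑ) (x : C → ℝ) (c : C) :
    ∑ i, x (N.s (N.enum c i).1) = N.adjacency.mulVec x c := by
  classical
  have := Fintype.ofFinite E
  rw [Equiv.sum_comp (N.enum c) (fun e => x (N.s e.1)), Matrix.mulVec, dotProduct,
    ← Finset.sum_fiberwise (Finset.univ : Finset {e : E // N.t e = c}) (fun e => N.s e.1)]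
  refine Finset.sum_congr rfl fun c' _ => ?_
  rw [Finset.sum_congr rfl (g := fun _ => x c')
    (fun e he => by rw [(Finset.mem_filter.1 he).2]), Finset.sum_const, nsmul_eq_mul]
  congr 1
  simp only [RegularNetwork.adjacency, Matrix.of_apply]
  norm_cast
  rw [← Fintype.card_subtype, ← Nat.card_eq_fintype_card]
  refine Nat.card_congr ((Equiv.subtypeSubtypeEquivSubtypeInter (fun e => N.t e = c)
    (fun e => N.s e = c')).trans (Equiv.subtypeEquivRight fun e => and_comm))

lemma field_sum_eq_adjacency [Fintype C] [Finite E] (N : RegularNetwork C E ϑ) (x : C → ℝ)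
    (l : ℝ) : N.field (fun p => ∑ i, p.2.1 i) (x, l) = N.adjacency.mulVec x :=
  funext fun c => sum_inputs N x c

lemma adjacency_mulVec_liftVec [Fintype C] [Finite E] {N : RegularNetwork C E ϑ} {r : Setoid C}
    (hr : N.IsBalanced r) (x : Quotient r → ℝ) :
    N.adjacency.mulVec (liftVec x) = liftVec ((N.quotient r).adjacency.mulVec x) := by
  rw [← field_sum_eq_adjacency N _ 0, ← field_sum_eq_adjacency (N.quotient r) _ 0]
  refine field_liftVec hr (fun σ x₀ x l => ?_) x 0
  exact Equiv.sum_comp σ x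

/-- An eigenvector in the polydiagonal of a balanced coloring descends to the quotient network. -/
lemma exists_quotient_eigenvector [Fintype C] [Finite E] {N : RegularNetwork C E ϑ}
    {r : Setoid C} (hr : N.IsBalanced r) {μ : ℝ} {x : C → ℝ}
    (hx : N.adjacency.mulVec x = μ • x) (hxr : x ∈ polydiagonal r) :
    ∃ y, y ∈ Module.End.eigenspace (N.quotient r).adjacency.mulVecLin μ ∧ liftVec y = x := by
  obtain ⟨y, rfl⟩ := exists_eq_liftVec hxr
  refine ⟨y, ?_, rfl⟩
  rw [Module.End.mem_eigenspace_iff, Matrix.mulVecLin_apply]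
  apply liftVec_injective
  exact (adjacency_mulVec_liftVec hr y).symm.trans hx

lemma hasEigenvalue_quotient [Fintype C] [Finite E] {N : RegularNetwork C E ϑ}
    {r : Setoid C} (hr : N.IsBalanced r) {μ : ℝ} {x : C → ℝ}
    (hx : N.adjacency.mulVec x = μ • x) (hxr : x ∈ polydiagonal r) (h0 : x ≠ 0) :
    Module.End.HasEigenvalue (N.quotient r).adjacency.mulVecLin μ := by
  obtain ⟨y, hy, rfl⟩ := exists_quotient_eigenvector hr hx hxr
  refine Module.End.hasEigenvalue_of_hasEigenvector (x := y) ⟨hy, ?_⟩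
  rintro rfl
  exact h0 rfl

/-- The geometric multiplicity does not exceed the algebraic one, so two eigenvectors in the
polydiagonal of a coloring with simple eigenvalue are dependent. -/
lemma not_linearIndependent_of_algMult_eq_one [Fintype C] [Finite E]
    {N : RegularNetwork C E ϑ} {r : Setoid C} (hr : N.IsBalanced r) {μ : ℝ}
    (h1 : algMult (N.quotient r).adjacency μ = 1) {x : Fin 2 → C → ℝ}
    (hx : ∀ i, N.adjacency.mulVec (x i) = μ • x i) (hxr : ∀ i, x i ∈ polydiagonal r) :
    ¬ LinearIndependent ℝ x := by
  intro hli
  choose y hy hyx using fun i => exists_quotient_eigenvector hr (hx i) (hxr i)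
  have hly : LinearIndependent ℝ y := by
    refine LinearIndependent.of_comp (liftLin r) ?_
    convert hli using 1
    exact funext hyx
  have hly' : LinearIndependent ℝ
      (fun i => (⟨y i, hy i⟩ : Module.End.eigenspace (N.quotient r).adjacency.mulVecLin μ)) :=
    LinearIndependent.of_comp (Submodule.subtype _) hly
  have h2 := hly'.fintype_card_le_finrank
  have h3 := LinearMap.finrank_eigenspace_le (N.quotient r).adjacency.mulVecLin μ
  rw [Fintype.card_fin] at h2
  unfold algMult at h1
  omega

lemma isBalanced_top (N : RegularNetwork C E ϑ) [Finite E] : N.IsBalanced ⊤ :=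
  fun c d _ => ⟨(N.enum c).symm.trans (N.enum d), fun _ => trivial⟩

/-- The coloring `r'` of `N`, coarser than `r`, seen as a coloring of `N/r`, is balanced. -/
lemma isBalanced_comap_out {N : RegularNetwork C E ϑ} {r r' : Setoid C} (hr' : N.IsBalanced r')
    (h : r ≤ r') : (N.quotient r).IsBalanced (r'.comap Quotient.out) := by
  intro q q' hq
  obtain ⟨φ, hφ⟩ := hr' q.out q'.out hq
  obtain ⟨ψ, hψ⟩ := exists_input_equiv_quotient N r q
  obtain ⟨ψ', hψ'⟩ := exists_input_equiv_quotient N r q'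
  refine ⟨ψ.trans (φ.trans ψ'.symm), fun e => ?_⟩
  have hout : ∀ c, r' (Quotient.mk r c).out c := fun c =>
    h (Quotient.exact (Quotient.out_eq (Quotient.mk r c)))
  rw [Setoid.comap_rel, hψ, hψ']
  simp only [Equiv.trans_apply, Equiv.apply_symm_apply]
  exact r'.trans' (hout _) (r'.trans' (hφ _) (r'.symm' (hout _)))

lemma mem_polydiagonal_comap_out {r r' : Setoid C} (h : r ≤ r') {x : Quotient r → ℝ} :
    x ∈ polydiagonal (r'.comap Quotient.out) ↔ liftVec x ∈ polydiagonal r' := by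
  have hout : ∀ c, r' (Quotient.mk r c).out c := fun c =>
    h (Quotient.exact (Quotient.out_eq (Quotient.mk r c)))
  refine ⟨fun hx c d hcd => hx _ _ ?_, fun hx q q' hq => ?_⟩
  · rw [Setoid.comap_rel]
    exact r'.trans' (hout _) (r'.trans' hcd (r'.symm' (hout _)))
  · have := hx _ _ hq
    simpa [liftVec] using this

lemma exists_ne_of_lt {r r' : Setoid C} (h : r < r') :
    ∃ c d, r' c d ∧ (Quotient.mk r c) ≠ Quotient.mk r d := by
  by_contra! hcon
  exact h.not_ge fun c d hcd => Quotient.exact (hcon c d hcd)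

lemma bot_lt_comap_out {r r' : Setoid C} (h : r < r') :
    (⊥ : Setoid (Quotient r)) < r'.comap Quotient.out := by
  have hout : ∀ c, r' (Quotient.mk r c).out c := fun c =>
    h.le (Quotient.exact (Quotient.out_eq (Quotient.mk r c)))
  obtain ⟨c, d, hcd, hne⟩ := exists_ne_of_lt h
  refine lt_of_le_of_ne bot_le fun heq => hne ?_
  have : (r'.comap Quotient.out) (Quotient.mk r c) (Quotient.mk r d) := by
    rw [Setoid.comap_rel]
    exact r'.trans' (hout _) (r'.trans' hcd (r'.symm' (hout _)))
  rw [← heq] at this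
  exact this

lemma bot_lt_top_of_lt {r r' : Setoid C} (h : r < r') : (⊥ : Setoid (Quotient r)) < ⊤ :=
  (bot_lt_comap_out h).trans_le le_top

end Networks

/-! ### Permutation-invariant linear and bilinear forms -/

section Invariant

variable {n : ℕ}

lemma invariant_linear_eq (ℓ : (Fin n → ℝ) →ₗ[ℝ] ℝ)
    (h : ∀ (σ : Equiv.Perm (Fin n)) x, ℓ (x ∘ σ) = ℓ x) (x : Fin n → ℝ) :
    ℓ x = (if h : 0 < n then ℓ (Pi.single ⟨0, h⟩ 1) else 0) * ∑ i, x i := by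
  rcases Nat.eq_zero_or_pos n with rfl | hn
  · rw [Subsingleton.elim x 0, map_zero]
    simp
  rw [dif_pos hn, LinearMap.pi_apply_eq_sum_univ ℓ x, Finset.mul_sum]
  refine Finset.sum_congr rfl fun i _ => ?_
  rw [smul_eq_mul, mul_comm, ← h (Equiv.swap i ⟨0, hn⟩)]
  congr 2
  ext j
  simp only [Function.comp_apply, Pi.single_apply]
  congr 1
  rw [eq_comm (a := i), Equiv.swap_apply_eq_iff, Equiv.swap_apply_left]

lemma exists_perm_pair {i j i₀ j₀ : Fin n} (h : i ≠ j) (h₀ : i₀ ≠ j₀) :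
    ∃ σ : Equiv.Perm (Fin n), σ i = i₀ ∧ σ j = j₀ := by
  have hj : Equiv.swap i i₀ j ≠ i₀ := fun hc => h (by
    rw [Equiv.swap_apply_eq_iff, Equiv.swap_apply_right] at hc
    exact hc.symm)
  refine ⟨(Equiv.swap i i₀).trans (Equiv.swap (Equiv.swap i i₀ j) j₀), ?_, ?_⟩
  · simp [Equiv.swap_apply_of_ne_of_ne hj.symm h₀]
  · simp

/-- A bilinear form that is invariant under permutations of the coordinates has equal diagonal entries
and equal off-diagonal entries. -/
lemma exists_invariant_bilinear_eq (B : (Fin n → ℝ) →ₗ[ℝ] (Fin n → ℝ) →ₗ[ℝ] ℝ)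
    (h : ∀ (σ : Equiv.Perm (Fin n)) x y, B (x ∘ σ) (y ∘ σ) = B x y) :
    ∃ b₁ b₂ : ℝ, ∀ x y, B x y = b₁ * ∑ i, x i * y i + b₂ * ((∑ i, x i) * ∑ i, y i) := by
  let e : Fin n → Fin n → ℝ := fun i j => if i = j then 1 else 0
  have he : ∀ (σ : Equiv.Perm (Fin n)) i, e (σ i) ∘ σ = e i := fun σ i => by
    ext j
    simp [e]
  have hβ : ∀ (σ : Equiv.Perm (Fin n)) i j, B (e (σ i)) (e (σ j)) = B (e i) (e j) :=
    fun σ i j => by rw [← h σ, he, he]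
  obtain ⟨β₁, hβ₁⟩ : ∃ β, ∀ i, B (e i) (e i) = β := by
    rcases isEmpty_or_nonempty (Fin n) with _ | ⟨⟨i₀⟩⟩
    · exact ⟨0, fun i => isEmptyElim i⟩
    · refine ⟨B (e i₀) (e i₀), fun i => ?_⟩
      rw [← hβ (Equiv.swap i i₀) i i, Equiv.swap_apply_left]
  obtain ⟨β₂, hβ₂⟩ : ∃ β, ∀ i j, i ≠ j → B (e i) (e j) = β := by
    by_cases hex : ∃ i₀ j₀ : Fin n, i₀ ≠ j₀
    · obtain ⟨i₀, j₀, h₀⟩ := hex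
      refine ⟨B (e i₀) (e j₀), fun i j hij => ?_⟩
      obtain ⟨σ, hi, hj⟩ := exists_perm_pair hij h₀
      rw [← hβ σ i j, hi, hj]
    · push Not at hex
      exact ⟨0, fun i j hij => absurd (hex i j) hij⟩
  refine ⟨β₁ - β₂, β₂, fun x y => ?_⟩
  have h1 : B x y = ∑ i, ∑ j, x i * (y j * B (e i) (e j)) := by
    rw [← LinearMap.flip_apply, LinearMap.pi_apply_eq_sum_univ (B.flip y) x]
    refine Finset.sum_congr rfl fun i _ => ?_
    rw [LinearMap.flip_apply, LinearMap.pi_apply_eq_sum_univ (B _) y, smul_eq_mul, Finset.mul_sum]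
    simp only [smul_eq_mul]
    rfl
  have h2 : ∀ i j, B (e i) (e j) = β₂ + (if i = j then β₁ - β₂ else 0) := by
    intro i j
    split_ifs with hij
    · rw [hij, hβ₁]; ring
    · rw [hβ₂ i j hij, add_zero]
  rw [h1, Finset.sum_mul_sum, Finset.mul_sum, Finset.mul_sum, ← Finset.sum_add_distrib]
  refine Finset.sum_congr rfl fun i _ => ?_
  simp only [h2, mul_add, Finset.sum_add_distrib, mul_ite, mul_zero, Finset.sum_ite_eq,
    Finset.mem_univ, if_true, Finset.mul_sum]
  rw [add_comm]
  congr 1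
  · ring
  · exact Finset.sum_congr rfl fun j _ => by ring

end Invariant

/-! ### The 2-jet of an admissible vector field -/

section Jet

variable {ϑ : ℕ} {f : ℝ × (Fin ϑ → ℝ) × ℝ → ℝ}

lemma contDiffAt_of_mem_bifClass {μ : ℝ} (hf : f ∈ bifClass ϑ μ) : ContDiffAt ℝ ∞ f 0 := by
  obtain ⟨⟨U, hU, hfU⟩, -⟩ := hf
  exact hfU.contDiffAt hU

/-- Permutation of the inputs. -/
noncomputable def permInputs (σ : Equiv.Perm (Fin ϑ)) :
    (ℝ × (Fin ϑ → ℝ) × ℝ) ≃L[ℝ] (ℝ × (Fin ϑ → ℝ) × ℝ) :=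
  ((LinearEquiv.refl ℝ ℝ).prodCongr ((LinearEquiv.funCongrLeft ℝ ℝ σ).prodCongr
    (LinearEquiv.refl ℝ ℝ))).toContinuousLinearEquiv

lemma permInputs_apply (σ : Equiv.Perm (Fin ϑ)) (x₀ : ℝ) (x : Fin ϑ → ℝ) (l : ℝ) :
    permInputs σ (x₀, x, l) = (x₀, x ∘ σ, l) := rfl

lemma fderiv_permInputs
    (hf : ∀ (σ : Equiv.Perm (Fin ϑ)) x₀ x l, f (x₀, x ∘ σ, l) = f (x₀, x, l))
    (σ : Equiv.Perm (Fin ϑ)) (Y V : ℝ × (Fin ϑ → ℝ) × ℝ) :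
    fderiv ℝ f (permInputs σ Y) (permInputs σ V) = fderiv ℝ f Y V := by
  have h : f ∘ permInputs σ = f := funext fun p => hf σ p.1 p.2.1 p.2.2
  have := (permInputs σ).comp_right_fderiv (f := f) (x := Y)
  rw [h] at this
  rw [this]
  rfl

lemma hasFDerivAt_fderiv {E F : Type*} [NormedAddCommGroup E] [NormedSpace ℝ E]
    [NormedAddCommGroup F] [NormedSpace ℝ F] {g : E → F} {x : E} (hg : ContDiffAt ℝ ∞ g x) :
    HasFDerivAt (fderiv ℝ g) (fderiv ℝ (fderiv ℝ g) x) x :=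
  ((hg.fderiv_right (m := 1) (by norm_cast)).differentiableAt one_ne_zero).hasFDerivAt

lemma fderiv_fderiv_permInputs (hs : ContDiffAt ℝ ∞ f 0)
    (hf : ∀ (σ : Equiv.Perm (Fin ϑ)) x₀ x l, f (x₀, x ∘ σ, l) = f (x₀, x, l))
    (σ : Equiv.Perm (Fin ϑ)) (V W : ℝ × (Fin ϑ → ℝ) × ℝ) :
    fderiv ℝ (fderiv ℝ f) 0 (permInputs σ V) (permInputs σ W) =
      fderiv ℝ (fderiv ℝ f) 0 V W := by
  have h0 := hasFDerivAt_fderiv hs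
  have h1 : HasFDerivAt (fun Y => fderiv ℝ f Y W) ((fderiv ℝ (fderiv ℝ f) 0).flip W) 0 := by
    have := h0.clm_apply (hasFDerivAt_const (𝕜 := ℝ) W 0)
    refine this.congr_fderiv ?_
    ext <;> simp
  have h2 : HasFDerivAt (fun Y => fderiv ℝ f (permInputs σ Y) (permInputs σ W))
      (((fderiv ℝ (fderiv ℝ f) 0).flip (permInputs σ W)).comp
        (permInputs σ : (ℝ × (Fin ϑ → ℝ) × ℝ) →L[ℝ] (ℝ × (Fin ϑ → ℝ) × ℝ))) 0 := by
    have h0' : HasFDerivAt (fderiv ℝ f) (fderiv ℝ (fderiv ℝ f) 0) (permInputs σ 0) := by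
      rw [map_zero]; exact h0
    have h3 := (h0'.comp 0 (permInputs σ).hasFDerivAt).clm_apply
      (hasFDerivAt_const (𝕜 := ℝ) (permInputs σ W) 0)
    refine h3.congr_fderiv ?_
    ext <;> simp
  simp only [fderiv_permInputs hf] at h2
  exact congrArg (fun T => T V) (h2.unique h1)

lemma fderiv_apply_eq
    (hf : ∀ (σ : Equiv.Perm (Fin ϑ)) x₀ x l, f (x₀, x ∘ σ, l) = f (x₀, x, l))
    (h0 : ∀ l, f (0, 0, l) = 0) (hd : DifferentiableAt ℝ f 0) (x₀ : ℝ) (x : Fin ϑ → ℝ) (l : ℝ) :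
    fderiv ℝ f 0 (x₀, x, l) = dSelf f 0 * x₀ + dInput f 0 * ∑ i, x i := by
  have hx : ((x₀, x, l) : ℝ × (Fin ϑ → ℝ) × ℝ) =
      x₀ • (1, 0, 0) + (0, x, 0) + l • (0, 0, 1) := by
    ext <;> simp
  have h1 : fderiv ℝ f 0 (0, 0, 1) = 0 := by
    have hc : HasDerivAt (fun t : ℝ => ((0, 0, t) : ℝ × (Fin ϑ → ℝ) × ℝ)) (0, 0, 1) 0 :=
      (hasDerivAt_const _ _).prodMk ((hasDerivAt_const _ _).prodMk (hasDerivAt_id _))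
    have h2 := HasFDerivAt.comp_hasDerivAt (0 : ℝ) (l := f) (l' := fderiv ℝ f 0)
      (f := fun t : ℝ => ((0, 0, t) : ℝ × (Fin ϑ → ℝ) × ℝ)) hd.hasFDerivAt hc
    have h3 : f ∘ (fun t : ℝ => ((0, 0, t) : ℝ × (Fin ϑ → ℝ) × ℝ)) = fun _ => 0 := funext h0
    rw [h3] at h2
    exact h2.unique (hasDerivAt_const _ _)
  have h4 := invariant_linear_eq
    ((fderiv ℝ f 0).toLinearMap ∘ₗ LinearMap.inr ℝ ℝ _ ∘ₗ LinearMap.inl ℝ (Fin ϑ → ℝ) ℝ)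
    (fun σ y => by
      have := fderiv_permInputs hf σ 0 (0, y, 0)
      rw [map_zero, permInputs_apply] at this
      simpa using this) x
  rw [hx, map_add, map_add, map_smul, map_smul, h1]
  simp only [LinearMap.comp_apply, LinearMap.inl_apply, LinearMap.inr_apply,
    ContinuousLinearMap.coe_coe] at h4
  rw [h4]
  simp only [smul_eq_mul, mul_zero, add_zero, dSelf, dInput]
  rw [mul_comm x₀]
  rfl

lemma hasDerivAt_fderiv_parameter (hs : ContDiffAt ℝ ∞ f 0) (V : ℝ × (Fin ϑ → ℝ) × ℝ) :
    HasDerivAt (fun l : ℝ => fderiv ℝ f (0, 0, l) V) (fderiv ℝ (fderiv ℝ f) 0 (0, 0, 1) V) 0 := by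
  have hc : HasDerivAt (fun t : ℝ => ((0, 0, t) : ℝ × (Fin ϑ → ℝ) × ℝ)) (0, 0, 1) 0 :=
    (hasDerivAt_const _ _).prodMk ((hasDerivAt_const _ _).prodMk (hasDerivAt_id _))
  have h2 := HasFDerivAt.comp_hasDerivAt (0 : ℝ) (l := fderiv ℝ f)
    (l' := fderiv ℝ (fderiv ℝ f) 0)
    (f := fun t : ℝ => ((0, 0, t) : ℝ × (Fin ϑ → ℝ) × ℝ)) (hasFDerivAt_fderiv hs) hc
  have := h2.clm_apply (hasDerivAt_const (0 : ℝ) V)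
  simpa using this

lemma deriv_dSelf (hs : ContDiffAt ℝ ∞ f 0) :
    deriv (dSelf f) 0 = fderiv ℝ (fderiv ℝ f) 0 (0, 0, 1) (1, 0, 0) :=
  (hasDerivAt_fderiv_parameter hs _).deriv

lemma deriv_dInput (hs : ContDiffAt ℝ ∞ f 0) :
    deriv (dInput f) 0 = if h : 0 < ϑ then
      fderiv ℝ (fderiv ℝ f) 0 (0, 0, 1) (0, Pi.single ⟨0, h⟩ 1, 0) else 0 := by
  unfold dInput
  split_ifs with h
  · exact (hasDerivAt_fderiv_parameter hs _).deriv
  · simp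

/-- The Hessian at the origin of a function that is symmetric in the inputs and vanishes on the
trivial branch. -/
lemma exists_hessian_eq (hs : ContDiffAt ℝ ∞ f 0)
    (hf : ∀ (σ : Equiv.Perm (Fin ϑ)) x₀ x l, f (x₀, x ∘ σ, l) = f (x₀, x, l))
    (h0 : ∀ l, f (0, 0, l) = 0) :
    ∃ b₀₀ b₀₁ b₁ b₂ : ℝ, ∀ (x₀ y₀ : ℝ) (x y : Fin ϑ → ℝ) (l l' : ℝ),
      fderiv ℝ (fderiv ℝ f) 0 (x₀, x, l) (y₀, y, l') =
        b₀₀ * (x₀ * y₀) + b₀₁ * (x₀ * ∑ i, y i + y₀ * ∑ i, x i) + b₁ * ∑ i, x i * y i +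
          b₂ * ((∑ i, x i) * ∑ i, y i) +
        l * (deriv (dSelf f) 0 * y₀ + deriv (dInput f) 0 * ∑ i, y i) +
        l' * (deriv (dSelf f) 0 * x₀ + deriv (dInput f) 0 * ∑ i, x i) := by
  set D := fderiv ℝ (fderiv ℝ f) 0 with hD
  have hsymm : ∀ X Y, D X Y = D Y X := fun X Y => (hs.isSymmSndFDerivAt (by simp; norm_cast)) X Y
  let j : (Fin ϑ → ℝ) →ₗ[ℝ] ℝ × (Fin ϑ → ℝ) × ℝ :=
    LinearMap.inr ℝ ℝ _ ∘ₗ LinearMap.inl ℝ (Fin ϑ → ℝ) ℝ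
  have hj : ∀ x, j x = (0, x, 0) := fun _ => rfl
  have hinv : ∀ σ : Equiv.Perm (Fin ϑ), ∀ V W, D (permInputs σ V) (permInputs σ W) = D V W :=
    fderiv_fderiv_permInputs hs hf
  let D' : (ℝ × (Fin ϑ → ℝ) × ℝ) →ₗ[ℝ] (ℝ × (Fin ϑ → ℝ) × ℝ) →ₗ[ℝ] ℝ := D.toLinearMap₁₂
  have hD' : ∀ V W, D' V W = D V W := fun _ _ => rfl
  -- the four blocks of `D`, except for the one in the parameter alone, which vanishes
  obtain ⟨b₁, b₂, hb⟩ := exists_invariant_bilinear_eq (D'.compl₁₂ j j) (fun σ x y => by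
    have := hinv σ (0, x, 0) (0, y, 0)
    rw [permInputs_apply, permInputs_apply] at this
    simpa [hD', hj] using this)
  have h01 := invariant_linear_eq (D' (1, 0, 0) ∘ₗ j) (fun σ x => by
    have := hinv σ (1, 0, 0) (0, x, 0)
    rw [permInputs_apply, permInputs_apply] at this
    simpa [hD', hj] using this)
  have hl1 := invariant_linear_eq (D' (0, 0, 1) ∘ₗ j) (fun σ x => by
    have := hinv σ (0, 0, 1) (0, x, 0)
    rw [permInputs_apply, permInputs_apply] at this
    simpa [hD', hj] using this)
  have hll : D (0, 0, 1) (0, 0, 1) = 0 := by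
    have h1 := hasDerivAt_fderiv_parameter hs (0, 0, 1)
    have h2 : (fun l : ℝ => fderiv ℝ f (0, 0, l) (0, 0, 1)) =ᶠ[𝓝 0] fun _ => 0 := by
      have hev : ∀ᶠ p in 𝓝 (0 : ℝ × (Fin ϑ → ℝ) × ℝ), DifferentiableAt ℝ f p :=
        ((hs.of_le (by norm_cast : (1 : ℕ∞ω) ≤ ∞)).eventually (by simp)).mono
          fun X hX => hX.differentiableAt one_ne_zero
      have hct : Filter.Tendsto (fun t : ℝ => ((0, 0, t) : ℝ × (Fin ϑ → ℝ) × ℝ)) (𝓝 0) (𝓝 0) := by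
        have : Continuous (fun t : ℝ => ((0, 0, t) : ℝ × (Fin ϑ → ℝ) × ℝ)) := by fun_prop
        exact this.tendsto 0
      filter_upwards [hct.eventually hev] with l hl
      have hc : HasDerivAt (fun t : ℝ => ((0, 0, t) : ℝ × (Fin ϑ → ℝ) × ℝ)) (0, 0, 1) l :=
        (hasDerivAt_const _ _).prodMk ((hasDerivAt_const _ _).prodMk (hasDerivAt_id _))
      have h2 := HasFDerivAt.comp_hasDerivAt l (l := f) (l' := fderiv ℝ f (0, 0, l))
        (f := fun t : ℝ => ((0, 0, t) : ℝ × (Fin ϑ → ℝ) × ℝ)) hl.hasFDerivAt hc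
      have h3 : f ∘ (fun t : ℝ => ((0, 0, t) : ℝ × (Fin ϑ → ℝ) × ℝ)) = fun _ => 0 := funext h0
      rw [h3] at h2
      exact h2.unique (hasDerivAt_const _ _)
    exact (h1.congr_of_eventuallyEq h2.symm).unique (hasDerivAt_const _ _)
  simp only [LinearMap.compl₁₂_apply, LinearMap.comp_apply, hj, hD'] at hb h01 hl1
  rw [← deriv_dInput hs] at hl1
  obtain ⟨b₀₁, h01⟩ : ∃ b, ∀ x, D (1, 0, 0) (0, x, 0) = b * ∑ i, x i := ⟨_, h01⟩
  have hl0 := (deriv_dSelf hs).symm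
  rw [← hD] at hl0
  refine ⟨D (1, 0, 0) (1, 0, 0), b₀₁, b₁, b₂, fun x₀ y₀ x y l l' => ?_⟩
  have hx : ∀ (x₀ : ℝ) (x : Fin ϑ → ℝ) (l : ℝ), ((x₀, x, l) : ℝ × (Fin ϑ → ℝ) × ℝ) =
      x₀ • (1, 0, 0) + (0, x, 0) + l • (0, 0, 1) := by
    intro x₀ x l
    ext <;> simp
  rw [hx x₀ x l, hx y₀ y l']
  simp only [map_add, map_smul, add_apply, smul_apply, smul_eq_mul]
  rw [hsymm (0, x, 0) (1, 0, 0), hsymm (1, 0, 0) (0, 0, 1), hsymm (0, x, 0) (0, 0, 1), hll, hl0,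
    h01 x, h01 y, hl1 x, hl1 y, hb x y]
  ring

end Jet

section FieldJet

/-- The functions that can occur as right-hand sides of an admissible vector field with the trivial
branch of solutions: smooth at the origin, symmetric in the inputs, and zero at `(0, …, 0, λ)`. -/
structure IsResponse {ϑ : ℕ} (f : ℝ × (Fin ϑ → ℝ) × ℝ → ℝ) : Prop where
  smooth : ContDiffAt ℝ ∞ f 0
  symm : ∀ (σ : Equiv.Perm (Fin ϑ)) x₀ x l, f (x₀, x ∘ σ, l) = f (x₀, x, l)
  zero : ∀ l, f (0, 0, l) = 0

lemma isResponse_of_mem_bifClass {ϑ : ℕ} {μ : ℝ} {f : ℝ × (Fin ϑ → ℝ) × ℝ → ℝ}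
    (hf : f ∈ bifClass ϑ μ) : IsResponse f :=
  ⟨contDiffAt_of_mem_bifClass hf, hf.2.1, hf.2.2.1⟩

variable {C E : Type*} [Finite E] {ϑ : ℕ}

/-- The states of a cell, of the sources of its inputs, and the parameter. -/
noncomputable def cellMap (N : RegularNetwork C E ϑ) (c : C) :
    ((C → ℝ) × ℝ) →L[ℝ] ℝ × (Fin ϑ → ℝ) × ℝ :=
  ((ContinuousLinearMap.proj c).comp (ContinuousLinearMap.fst ℝ (C → ℝ) ℝ)).prod
    ((ContinuousLinearMap.pi fun i => (ContinuousLinearMap.proj (N.s (N.enum c i).1)).comp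
      (ContinuousLinearMap.fst ℝ (C → ℝ) ℝ)).prod (ContinuousLinearMap.snd ℝ (C → ℝ) ℝ))

lemma cellMap_apply (N : RegularNetwork C E ϑ) (c : C) (x : C → ℝ) (l : ℝ) :
    cellMap N c (x, l) = (x c, fun i => x (N.s (N.enum c i).1), l) := rfl

lemma field_zero (N : RegularNetwork C E ϑ) {f : ℝ × (Fin ϑ → ℝ) × ℝ → ℝ}
    (hf : IsResponse f) (l : ℝ) :
    N.field f (0, l) = 0 :=
  funext fun _ => hf.zero l

lemma mul_mem_polydiagonal {r : Setoid C} {x y : C → ℝ} (hx : x ∈ polydiagonal r)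
    (hy : y ∈ polydiagonal r) : x * y ∈ polydiagonal r := fun c d h => by
  rw [Pi.mul_apply, Pi.mul_apply, hx c d h, hy c d h]

variable [Fintype C] (N : RegularNetwork C E ϑ) {f : ℝ × (Fin ϑ → ℝ) × ℝ → ℝ}

lemma contDiffAt_field (hs : ContDiffAt ℝ ∞ f 0) : ContDiffAt ℝ ∞ (N.field f) 0 := by
  rw [contDiffAt_pi]
  intro c
  have h : ContDiffAt ℝ ∞ f (cellMap N c 0) := by rwa [map_zero]
  exact h.comp 0 (cellMap N c).contDiff.contDiffAt

lemma hasFDerivAt_field {p : (C → ℝ) × ℝ} (hd : ∀ c, DifferentiableAt ℝ f (cellMap N c p)) :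
    HasFDerivAt (N.field f)
      (ContinuousLinearMap.pi fun c => (fderiv ℝ f (cellMap N c p)).comp (cellMap N c)) p := by
  rw [hasFDerivAt_pi]
  intro c
  exact (hd c).hasFDerivAt.comp p (cellMap N c).hasFDerivAt

lemma fderiv_field_apply (hf : IsResponse f) (x : C → ℝ) (l : ℝ) :
    fderiv ℝ (N.field f) 0 (x, l) = dSelf f 0 • x + dInput f 0 • N.adjacency.mulVec x := by
  have hd : DifferentiableAt ℝ f 0 := hf.smooth.differentiableAt (by simp)
  rw [(hasFDerivAt_field N (fun c => by rwa [map_zero])).fderiv]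
  ext c
  simp only [ContinuousLinearMap.coe_pi', ContinuousLinearMap.comp_apply, map_zero, cellMap_apply,
    Pi.add_apply, Pi.smul_apply, smul_eq_mul]
  rw [fderiv_apply_eq hf.symm hf.zero hd, sum_inputs]

/-- The Jacobian is a linear combination of the identity and the adjacency matrix. -/
lemma jac_apply (hf : IsResponse f) (x : C → ℝ) :
    N.jac f x = dSelf f 0 • x + dInput f 0 • N.adjacency.mulVec x := by
  have hd : DifferentiableAt ℝ (N.field f) 0 :=
    (contDiffAt_field N hf.smooth).differentiableAt (by simp)
  have h1 : HasFDerivAt (fun x => N.field f (x, 0))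
      ((fderiv ℝ (N.field f) 0).comp (ContinuousLinearMap.inl ℝ (C → ℝ) ℝ)) 0 :=
    HasFDerivAt.comp (0 : C → ℝ) (g := N.field f) hd.hasFDerivAt (hasFDerivAt_prodMk_left 0 0)
  unfold RegularNetwork.jac
  rw [h1.fderiv, ContinuousLinearMap.comp_apply]
  exact fderiv_field_apply N hf x 0

lemma fderiv_field_eq_jac (hf : IsResponse f) (x : C → ℝ) (l : ℝ) :
    fderiv ℝ (N.field f) 0 (x, l) = N.jac f x := by
  rw [fderiv_field_apply N hf, jac_apply N hf]

lemma fderiv_fderiv_field_apply (hs : ContDiffAt ℝ ∞ f 0) (p q : (C → ℝ) × ℝ) (c : C) :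
    fderiv ℝ (fderiv ℝ (N.field f)) 0 p q c =
      fderiv ℝ (fderiv ℝ f) 0 (cellMap N c p) (cellMap N c q) := by
  have hev : ∀ᶠ x in 𝓝 (0 : ℝ × (Fin ϑ → ℝ) × ℝ), DifferentiableAt ℝ f x :=
    ((hs.of_le (by norm_cast : (1 : ℕ∞ω) ≤ ∞)).eventually (by simp)).mono
      fun X hX => hX.differentiableAt one_ne_zero
  have hev' : ∀ᶠ p in 𝓝 (0 : (C → ℝ) × ℝ), ∀ c, DifferentiableAt ℝ f (cellMap N c p) := by
    rw [Filter.eventually_all]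
    intro c
    have : Filter.Tendsto (cellMap N c) (𝓝 0) (𝓝 0) := by
      simpa using (cellMap N c).continuous.tendsto 0
    exact this.eventually hev
  have h1 : (fun p => fderiv ℝ (N.field f) p q c) =ᶠ[𝓝 0]
      fun p => fderiv ℝ f (cellMap N c p) (cellMap N c q) := by
    filter_upwards [hev'] with p hp
    rw [(hasFDerivAt_field N hp).fderiv]
    rfl
  have h2 : HasFDerivAt (fun p => fderiv ℝ (N.field f) p q c)
      ((ContinuousLinearMap.proj c).comp ((fderiv ℝ (fderiv ℝ (N.field f)) 0).flip q)) 0 := by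
    have := (hasFDerivAt_fderiv (contDiffAt_field N hs)).clm_apply
      (hasFDerivAt_const (𝕜 := ℝ) q 0)
    have h3 := (ContinuousLinearMap.proj (R := ℝ) (φ := fun _ : C => ℝ) c).hasFDerivAt.comp 0 this
    refine h3.congr_fderiv ?_
    ext <;> simp
  have h3 : HasFDerivAt (fun p => fderiv ℝ f (cellMap N c p) (cellMap N c q))
      (((fderiv ℝ (fderiv ℝ f) 0).flip (cellMap N c q)).comp (cellMap N c)) 0 := by
    have hs' : HasFDerivAt (fderiv ℝ f) (fderiv ℝ (fderiv ℝ f) 0) (cellMap N c 0) := by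
      rw [map_zero]; exact hasFDerivAt_fderiv hs
    have := (hs'.comp 0 (cellMap N c).hasFDerivAt).clm_apply
      (hasFDerivAt_const (𝕜 := ℝ) (cellMap N c q) 0)
    refine this.congr_fderiv ?_
    ext <;> simp
  exact congrArg (fun T => T p) (h2.unique (h3.congr_of_eventuallyEq h1))

lemma exists_field_hessian_eq (hf : IsResponse f) :
    ∃ b₀₀ b₀₁ b₁ b₂ : ℝ, ∀ (x y : C → ℝ) (l l' : ℝ),
      fderiv ℝ (fderiv ℝ (N.field f)) 0 (x, l) (y, l') =
        b₀₀ • (x * y) + b₀₁ • (x * N.adjacency.mulVec y + y * N.adjacency.mulVec x) +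
          b₁ • N.adjacency.mulVec (x * y) +
          b₂ • (N.adjacency.mulVec x * N.adjacency.mulVec y) +
        l • (deriv (dSelf f) 0 • y + deriv (dInput f) 0 • N.adjacency.mulVec y) +
        l' • (deriv (dSelf f) 0 • x + deriv (dInput f) 0 • N.adjacency.mulVec x) := by
  obtain ⟨b₀₀, b₀₁, b₁, b₂, hb⟩ := exists_hessian_eq hf.smooth hf.symm hf.zero
  refine ⟨b₀₀, b₀₁, b₁, b₂, fun x y l l' => ?_⟩
  ext c
  rw [fderiv_fderiv_field_apply N hf.smooth, cellMap_apply, cellMap_apply, hb]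
  simp only [Pi.add_apply, Pi.smul_apply, Pi.mul_apply, smul_eq_mul, ← sum_inputs]

/-- On eigenvectors for `μ`, paired with a left eigenvector for `μ`, the Hessian of an admissible
vector field is a multiple of the coordinatewise product, and the mixed derivative in state and
parameter is the crossing speed. -/
lemma exists_hessian_eigenvectors (μ : ℝ) (hf : IsResponse f) :
    ∃ b : ℝ, ∀ (w x y : C → ℝ) (l l' : ℝ),
      (∀ z, w ⬝ᵥ N.adjacency.mulVec z = μ * (w ⬝ᵥ z)) →
      N.adjacency.mulVec x = μ • x → N.adjacency.mulVec y = μ • y →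
      w ⬝ᵥ fderiv ℝ (fderiv ℝ (N.field f)) 0 (x, l) (y, l') =
        b * (w ⬝ᵥ (x * y)) + crossing μ f * (l * (w ⬝ᵥ y) + l' * (w ⬝ᵥ x)) := by
  obtain ⟨b₀₀, b₀₁, b₁, b₂, hb⟩ := exists_field_hessian_eq N hf
  refine ⟨b₀₀ + 2 * b₀₁ * μ + b₁ * μ + b₂ * μ ^ 2, fun w x y l l' hw hx hy => ?_⟩
  rw [hb, hx, hy]
  have hxy : y * μ • x = μ • (x * y) := by ext; simp; ring
  have hxy' : x * μ • y = μ • (x * y) := by ext; simp; ring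
  have hxy2 : μ • x * μ • y = (μ ^ 2) • (x * y) := by ext; simp; ring
  rw [hxy, hxy', hxy2]
  simp only [dotProduct_add, dotProduct_smul, hw, smul_eq_mul, crossing]
  ring

variable {N} {r : Setoid C}

lemma adjacency_mem_polydiagonal (hr : N.IsBalanced r) {x : C → ℝ} (hx : x ∈ polydiagonal r) :
    N.adjacency.mulVec x ∈ polydiagonal r := by
  rw [← field_sum_eq_adjacency N x 0]
  exact field_mem_polydiagonal hr (fun σ _ x _ => Equiv.sum_comp σ x) hx 0

lemma jac_mem_polydiagonal (hf : IsResponse f) (hr : N.IsBalanced r) {x : C → ℝ}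
    (hx : x ∈ polydiagonal r) : N.jac f x ∈ polydiagonal r := by
  rw [jac_apply N hf]
  exact Submodule.add_mem _ (Submodule.smul_mem _ _ hx)
    (Submodule.smul_mem _ _ (adjacency_mem_polydiagonal hr hx))

lemma hessian_mem_polydiagonal (hf : IsResponse f) (hr : N.IsBalanced r) {x y : C → ℝ}
    (hx : x ∈ polydiagonal r) (hy : y ∈ polydiagonal r) (l l' : ℝ) :
    fderiv ℝ (fderiv ℝ (N.field f)) 0 (x, l) (y, l') ∈ polydiagonal r := by
  obtain ⟨b₀₀, b₀₁, b₁, b₂, hb⟩ := exists_field_hessian_eq N hf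
  have hAx := adjacency_mem_polydiagonal hr hx
  have hAy := adjacency_mem_polydiagonal hr hy
  have hA := adjacency_mem_polydiagonal hr (mul_mem_polydiagonal hx hy)
  rw [hb]
  refine Submodule.add_mem _ (Submodule.add_mem _ (Submodule.add_mem _ (Submodule.add_mem _
    (Submodule.add_mem _ ?_ ?_) ?_) ?_) ?_) ?_ <;> refine Submodule.smul_mem _ _ ?_
  · exact mul_mem_polydiagonal hx hy
  · exact Submodule.add_mem _ (mul_mem_polydiagonal hx hAy) (mul_mem_polydiagonal hy hAx)
  · exact hA
  · exact mul_mem_polydiagonal hAx hAy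
  · exact Submodule.add_mem _ (Submodule.smul_mem _ _ hy) (Submodule.smul_mem _ _ hAy)
  · exact Submodule.add_mem _ (Submodule.smul_mem _ _ hx) (Submodule.smul_mem _ _ hAx)

/-- If the derivative with respect to the inputs does not vanish, the kernel of the Jacobian is the
eigenspace of the adjacency matrix, and similarly for the left kernel. Without inputs the adjacency
matrix and the Jacobian both vanish. -/
lemma eigen_of_jac (hf : IsResponse f) {μ : ℝ} (hμ : dSelf f 0 + μ * dInput f 0 = 0)
    (h1 : dInput f 0 ≠ 0 ∨ ϑ = 0 ∧ μ = 0) :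
    (∀ x, N.jac f x = 0 → N.adjacency.mulVec x = μ • x) ∧
      ∀ w, (∀ z, w ⬝ᵥ N.jac f z = 0) →
        ∀ z, w ⬝ᵥ N.adjacency.mulVec z = μ * (w ⬝ᵥ z) := by
  have hJ : ∀ x, N.jac f x = dInput f 0 • (N.adjacency.mulVec x - μ • x) := by
    intro x
    rw [jac_apply N hf, eq_neg_of_add_eq_zero_left hμ]
    ext c
    simp
    ring
  rcases h1 with h1 | ⟨rfl, rfl⟩
  · refine ⟨fun x hx => ?_, fun w hw z => ?_⟩
    · rw [hJ, smul_eq_zero_iff_right h1, sub_eq_zero] at hx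
      exact hx
    · have := hw z
      rw [hJ, dotProduct_smul, smul_eq_zero_iff_right h1, dotProduct_sub, sub_eq_zero,
        dotProduct_smul, smul_eq_mul] at this
      exact this
  · have hA : ∀ x, N.adjacency.mulVec x = 0 := fun x => funext fun c => by
      rw [← sum_inputs]; simp
    simp [hA]

end FieldJet

/-! ### The 2-jet of the Lyapunov–Schmidt reduction -/

section ReductionJet

/-- The second derivative of a composition at a point where the outer first derivative vanishes: the
second derivative of the inner map does not contribute. -/
lemma fderiv_fderiv_comp {X Y V W : Type*} [NormedAddCommGroup X] [NormedSpace ℝ X]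
    [NormedAddCommGroup Y] [NormedSpace ℝ Y] [NormedAddCommGroup V] [NormedSpace ℝ V]
    [NormedAddCommGroup W] [NormedSpace ℝ W] {F : Y → V} {S : X → Y} {x : X} (T : V →L[ℝ] W)
    (hF : ContDiffAt ℝ ∞ F (S x)) (hS : ContDiffAt ℝ ∞ S x)
    (hT : ∀ y, T (fderiv ℝ F (S x) y) = 0) (u v : X) :
    fderiv ℝ (fderiv ℝ fun p => T (F (S p))) x u v =
      T (fderiv ℝ (fderiv ℝ F) (S x) (fderiv ℝ S x u) (fderiv ℝ S x v)) := by
  have hevF : ∀ᶠ p in 𝓝 x, DifferentiableAt ℝ F (S p) :=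
    hS.continuousAt.eventually (((hF.of_le (by norm_cast : (1 : ℕ∞ω) ≤ ∞)).eventually
      (by simp)).mono fun X hX => hX.differentiableAt one_ne_zero)
  have hevS : ∀ᶠ p in 𝓝 x, DifferentiableAt ℝ S p :=
    ((hS.of_le (by norm_cast : (1 : ℕ∞ω) ≤ ∞)).eventually
      (by simp)).mono fun X hX => hX.differentiableAt one_ne_zero
  have h1 : (fderiv ℝ fun p => T (F (S p))) =ᶠ[𝓝 x]
      fun p => T.comp ((fderiv ℝ F (S p)).comp (fderiv ℝ S p)) := by
    filter_upwards [hevF, hevS] with p hp hp'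
    exact (T.hasFDerivAt.comp p (hp.hasFDerivAt.comp p hp'.hasFDerivAt)).fderiv
  rw [h1.fderiv_eq]
  have hd := (hasFDerivAt_const (𝕜 := ℝ) T x).clm_comp (((hasFDerivAt_fderiv hF).comp x
    (hS.differentiableAt (by simp)).hasFDerivAt).clm_comp (hasFDerivAt_fderiv hS))
  have hd' := hd.fderiv
  simp only [Function.comp_apply] at hd'
  rw [hd']
  simp [hT]

variable {C E : Type*} {ϑ m : ℕ}

/-- The linear combination of the vectors `v i` with the coordinates of a point. -/
noncomputable def combCLM (v : Fin m → C → ℝ) : (Fin m → ℝ) →L[ℝ] (C → ℝ) :=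
  LinearMap.toContinuousLinearMap (Fintype.linearCombination ℝ v)

lemma combCLM_apply (v : Fin m → C → ℝ) (y : Fin m → ℝ) : combCLM v y = ∑ i, y i • v i := rfl

variable [Fintype C] [Finite E]

/-- Pairing with a fixed vector. -/
noncomputable def dotCLM (w : C → ℝ) : (C → ℝ) →L[ℝ] ℝ :=
  LinearMap.toContinuousLinearMap
    { toFun := fun x => w ⬝ᵥ x
      map_add' := dotProduct_add w
      map_smul' := fun a x => by simp }

lemma dotCLM_apply (w x : C → ℝ) : dotCLM w x = w ⬝ᵥ x := rfl

/-- `IsReduction`, with the solution `W` of the complementary equation exposed. -/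
structure IsReductionVia (N : RegularNetwork C E ϑ) (f : ℝ × (Fin ϑ → ℝ) × ℝ → ℝ)
    (v w : Fin m → C → ℝ) (g : (Fin m → ℝ) × ℝ → (Fin m → ℝ))
    (W : (Fin m → ℝ) × ℝ → (C → ℝ)) : Prop where
  contDiffAt : ContDiffAt ℝ ∞ W 0
  map_zero : W 0 = 0
  eventually : ∀ᶠ p in 𝓝 (0 : (Fin m → ℝ) × ℝ),
      (∀ x, N.jac f x = 0 → x ⬝ᵥ W p = 0) ∧
      (∀ z, N.jac f z ⬝ᵥ N.field f (∑ i, p.1 i • v i + W p, p.2) = 0) ∧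
      (∀ i, g p i = w i ⬝ᵥ N.field f (∑ i, p.1 i • v i + W p, p.2))

lemma fderiv_apply_eq_zero_of_eventually {X : Type*} [NormedAddCommGroup X] [NormedSpace ℝ X]
    {h : X → C → ℝ} {h' : X →L[ℝ] (C → ℝ)} {x : X} (hd : HasFDerivAt h h' x) (w : C → ℝ)
    (hz : ∀ᶠ p in 𝓝 x, w ⬝ᵥ h p = 0) (u : X) : w ⬝ᵥ h' u = 0 := by
  have h1 : HasFDerivAt (fun p => w ⬝ᵥ h p) ((dotCLM w).comp h') x :=
    (dotCLM w).hasFDerivAt.comp x hd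
  have h2 : HasFDerivAt (fun p => w ⬝ᵥ h p) (0 : X →L[ℝ] ℝ) x :=
    (hasFDerivAt_const (0 : ℝ) x).congr_of_eventuallyEq hz
  exact congrArg (fun T => T u) (h1.unique h2)

namespace IsReductionVia

variable {N : RegularNetwork C E ϑ} {f : ℝ × (Fin ϑ → ℝ) × ℝ → ℝ} {v w : Fin m → C → ℝ}
  {g : (Fin m → ℝ) × ℝ → (Fin m → ℝ)} {W : (Fin m → ℝ) × ℝ → (C → ℝ)}

/-- The state and parameter described by a point of the reduced space. -/
noncomputable def embed (v : Fin m → C → ℝ) (W : (Fin m → ℝ) × ℝ → (C → ℝ))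
    (p : (Fin m → ℝ) × ℝ) : (C → ℝ) × ℝ :=
  (∑ i, p.1 i • v i + W p, p.2)

lemma embed_zero (h : IsReductionVia N f v w g W) : embed v W 0 = 0 := by
  simp [embed, h.map_zero]

lemma hasFDerivAt_embed (h : IsReductionVia N f v w g W) : HasFDerivAt (embed v W)
    (((combCLM v).comp (ContinuousLinearMap.fst ℝ _ ℝ) + fderiv ℝ W 0).prod
      (ContinuousLinearMap.snd ℝ _ ℝ)) 0 := by
  refine HasFDerivAt.prodMk ?_ hasFDerivAt_snd
  exact (((combCLM v).hasFDerivAt).comp 0 hasFDerivAt_fst).add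
    (h.contDiffAt.differentiableAt (by simp)).hasFDerivAt

lemma contDiffAt_embed (h : IsReductionVia N f v w g W) : ContDiffAt ℝ ∞ (embed v W) 0 := by
  refine ContDiffAt.prodMk ?_ contDiffAt_snd
  exact ((combCLM v).contDiff.contDiffAt.comp 0 contDiffAt_fst).add h.contDiffAt

/-- The first jet of `W` vanishes: its values are orthogonal to the kernel of the Jacobian, and by the
complementary equation they are in the kernel. -/
lemma fderiv_eq_zero (hf : IsResponse f) (hb : IsReductionBasis N f v w)
    (h : IsReductionVia N f v w g W) :
    fderiv ℝ W 0 = 0 := by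
  refine ContinuousLinearMap.ext fun u => ?_
  set z := fderiv ℝ W 0 u with hz
  have hWd := (h.contDiffAt.differentiableAt (by simp)).hasFDerivAt
  have h1 : ∀ x, N.jac f x = 0 → x ⬝ᵥ z = 0 := fun x hx =>
    fderiv_apply_eq_zero_of_eventually hWd x (h.eventually.mono fun p hp => hp.1 x hx) u
  have hFd : HasFDerivAt (N.field f) (fderiv ℝ (N.field f) 0) (embed v W 0) := by
    rw [h.embed_zero]
    exact ((contDiffAt_field N hf.smooth).differentiableAt (by simp)).hasFDerivAt
  have hJ : ∀ y, N.jac f y ⬝ᵥ N.jac f z = 0 := by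
    intro y
    have := fderiv_apply_eq_zero_of_eventually (hFd.comp 0 h.hasFDerivAt_embed) (N.jac f y)
      (h.eventually.mono fun p hp => hp.2.1 y) u
    rw [← this]
    congr 1
    simp only [ContinuousLinearMap.comp_apply, ContinuousLinearMap.prod_apply, add_apply]
    rw [fderiv_field_eq_jac N hf, map_add]
    have hker : N.jac f (combCLM v u.1) = 0 :=
      (hb.2.1 _).1 (by
        rw [combCLM_apply]
        exact Submodule.sum_mem _ fun i _ => Submodule.smul_mem _ _
          (Submodule.subset_span ⟨i, rfl⟩))
    simp [hker, hz]
  have hz0 : N.jac f z = 0 := dotProduct_self_eq_zero.1 (hJ z)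
  exact dotProduct_self_eq_zero.1 (h1 z hz0)

lemma fderiv_embed (hf : IsResponse f) (hb : IsReductionBasis N f v w)
    (h : IsReductionVia N f v w g W) (p : (Fin m → ℝ) × ℝ) :
    fderiv ℝ (embed v W) 0 p = (∑ i, p.1 i • v i, p.2) := by
  rw [h.hasFDerivAt_embed.fderiv, h.fderiv_eq_zero hf hb, add_zero]
  rfl

lemma eventuallyEq (h : IsReductionVia N f v w g W) :
    g =ᶠ[𝓝 0] fun p => ContinuousLinearMap.pi (fun i => dotCLM (w i)) (N.field f (embed v W p)) :=
  h.eventually.mono fun _ hp => funext fun i => hp.2.2 i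

lemma contDiffAt_reduction (hf : IsResponse f) (h : IsReductionVia N f v w g W) :
    ContDiffAt ℝ ∞ g 0 := by
  refine ContDiffAt.congr_of_eventuallyEq ?_ h.eventuallyEq
  have hF : ContDiffAt ℝ ∞ (N.field f) (embed v W 0) := by
    rw [h.embed_zero]; exact contDiffAt_field N hf.smooth
  exact (ContinuousLinearMap.contDiff _).contDiffAt.comp 0 (hF.comp 0 h.contDiffAt_embed)

lemma reduction_zero (hf : IsResponse f) (h : IsReductionVia N f v w g W) : g 0 = 0 := by
  have hg := h.eventuallyEq.self_of_nhds
  dsimp only at hg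
  have hF : N.field f 0 = 0 := field_zero N hf 0
  rw [hg, h.embed_zero, hF, _root_.map_zero]

lemma fderiv_reduction (hf : IsResponse f) (hb : IsReductionBasis N f v w)
    (h : IsReductionVia N f v w g W) : fderiv ℝ g 0 = 0 := by
  rw [h.eventuallyEq.fderiv_eq]
  have hF : HasFDerivAt (N.field f) (fderiv ℝ (N.field f) 0) (embed v W 0) := by
    rw [h.embed_zero]
    exact ((contDiffAt_field N hf.smooth).differentiableAt (by simp)).hasFDerivAt
  have := (ContinuousLinearMap.pi (fun i => dotCLM (w i))).hasFDerivAt.comp 0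
    (hF.comp 0 h.hasFDerivAt_embed)
  rw [HasFDerivAt.fderiv (f := fun p => ContinuousLinearMap.pi (fun i => dotCLM (w i))
    (N.field f (embed v W p))) this]
  refine ContinuousLinearMap.ext fun u => funext fun i => ?_
  simp only [ContinuousLinearMap.comp_apply, ContinuousLinearMap.coe_pi', dotCLM_apply,
    ContinuousLinearMap.prod_apply]
  rw [fderiv_field_eq_jac N hf]
  exact (hb.2.2.2.1 _).1 (Submodule.subset_span ⟨i, rfl⟩) _

/-- Since the range of the Jacobian is annihilated by the `w i` and `W` has vanishing first jet, the
Hessian of the reduced map is the Hessian of the field, paired with the `w i`. -/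
lemma fderiv_fderiv_reduction (hf : IsResponse f) (hb : IsReductionBasis N f v w)
    (h : IsReductionVia N f v w g W) (p q : (Fin m → ℝ) × ℝ) (i : Fin m) :
    fderiv ℝ (fderiv ℝ g) 0 p q i = w i ⬝ᵥ fderiv ℝ (fderiv ℝ (N.field f)) 0
      (∑ j, p.1 j • v j, p.2) (∑ j, q.1 j • v j, q.2) := by
  rw [h.eventuallyEq.fderiv.fderiv_eq, fderiv_fderiv_comp (F := N.field f) (S := embed v W)
    (T := ContinuousLinearMap.pi fun i => dotCLM (w i))]
  · rw [h.fderiv_embed hf hb, h.fderiv_embed hf hb, h.embed_zero]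
    rfl
  · rw [h.embed_zero]; exact contDiffAt_field N hf.smooth
  · exact h.contDiffAt_embed
  · rintro ⟨y, l⟩
    rw [h.embed_zero, fderiv_field_eq_jac N hf]
    exact funext fun i => (hb.2.2.2.1 _).1 (Submodule.subset_span ⟨i, rfl⟩) _

lemma dot_sum_eq (hb : IsReductionBasis N f v w) (y : Fin m → ℝ) (i : Fin m) :
    w i ⬝ᵥ ∑ j, y j • v j = y i := by
  simp [dotProduct_sum, hb.2.2.2.2]

end IsReductionVia

/-- On the kernel of the Jacobian and paired with the left kernel, the Hessian of the field is `b`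
times the coordinatewise product, and the crossing speed in the mixed terms. -/
def HessianOnKernel (N : RegularNetwork C E ϑ) (f : ℝ × (Fin ϑ → ℝ) × ℝ → ℝ) (μ b : ℝ) : Prop :=
  ∀ (x y : C → ℝ) (l l' : ℝ) (w : C → ℝ), N.jac f x = 0 → N.jac f y = 0 →
    (∀ z, w ⬝ᵥ N.jac f z = 0) →
    w ⬝ᵥ fderiv ℝ (fderiv ℝ (N.field f)) 0 (x, l) (y, l') =
      b * (w ⬝ᵥ (x * y)) + crossing μ f * (l * (w ⬝ᵥ y) + l' * (w ⬝ᵥ x))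

lemma exists_hessianOnKernel {N : RegularNetwork C E ϑ} {f : ℝ × (Fin ϑ → ℝ) × ℝ → ℝ}
    (hf : IsResponse f) {μ : ℝ} (hμ : dSelf f 0 + μ * dInput f 0 = 0)
    (h1 : dInput f 0 ≠ 0 ∨ ϑ = 0 ∧ μ = 0) : ∃ b : ℝ, HessianOnKernel N f μ b := by
  obtain ⟨b, hb⟩ := exists_hessian_eigenvectors N μ hf
  obtain ⟨hx, hw⟩ := eigen_of_jac (N := N) hf hμ h1
  exact ⟨b, fun x y l l' w hx' hy' hw' => hb w x y l l' (hw w hw') (hx x hx') (hx y hy')⟩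

end ReductionJet

/-! ### Nondegenerate zeros of the blown-up map carry bifurcation branches -/

section Existence

variable {C E : Type*} {ϑ m : ℕ}

lemma iteratedFDeriv_two_state {g : (Fin m → ℝ) × ℝ → (Fin m → ℝ)} (hg : ContDiffAt ℝ ∞ g 0)
    (h1 : fderiv ℝ g 0 = 0) (u : Fin 2 → Fin m → ℝ) :
    iteratedFDeriv ℝ 2 (fun y => g (y, 0)) 0 u =
      fderiv ℝ (fderiv ℝ g) 0 (u 0, 0) (u 1, 0) := by
  rw [iteratedFDeriv_two_apply]
  have := fderiv_fderiv_comp (F := g) (S := fun y : Fin m → ℝ => (y, (0 : ℝ))) (x := 0)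
    (ContinuousLinearMap.id ℝ (Fin m → ℝ)) hg
    (ContinuousLinearMap.inl ℝ (Fin m → ℝ) ℝ).contDiff.contDiffAt (fun y => by
      change fderiv ℝ g 0 y = 0
      rw [h1]
      rfl) (u 0) (u 1)
  have hS : fderiv ℝ (fun y : Fin m → ℝ => (y, (0 : ℝ))) 0 =
    ContinuousLinearMap.inl ℝ (Fin m → ℝ) ℝ := (ContinuousLinearMap.inl ℝ (Fin m → ℝ) ℝ).fderiv
  rw [hS] at this
  exact this

/-- As the first jet of `g` vanishes, restricting `g` to `λ = 0` restricts its Hessian. -/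
lemma taylorForm_two {g : (Fin m → ℝ) × ℝ → (Fin m → ℝ)} (hg : ContDiffAt ℝ ∞ g 0)
    (h1 : fderiv ℝ g 0 = 0) (u : Fin m → ℝ) :
    taylorForm 2 g u = (2⁻¹ : ℝ) • fderiv ℝ (fderiv ℝ g) 0 (u, 0) (u, 0) := by
  unfold taylorForm
  rw [iteratedFDeriv_two_state hg h1]
  simp

variable [Fintype C] [Finite E] {N : RegularNetwork C E ϑ} {f : ℝ × (Fin ϑ → ℝ) × ℝ → ℝ}
  {v w : Fin m → C → ℝ} {g : (Fin m → ℝ) × ℝ → (Fin m → ℝ)} {W : (Fin m → ℝ) × ℝ → (C → ℝ)}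
  {μ b : ℝ}

lemma IsReductionBasis.jac_sum (hb : IsReductionBasis N f v w) (y : Fin m → ℝ) :
    N.jac f (∑ i, y i • v i) = 0 :=
  (hb.2.1 _).1 (Submodule.sum_mem _ fun i _ => Submodule.smul_mem _ _
    (Submodule.subset_span ⟨i, rfl⟩))

lemma IsReductionBasis.dot_jac (hb : IsReductionBasis N f v w) (i : Fin m) (z : C → ℝ) :
    w i ⬝ᵥ N.jac f z = 0 :=
  (hb.2.2.2.1 _).1 (Submodule.subset_span ⟨i, rfl⟩) z

lemma fderiv_fderiv_reduction_eq (hf : IsResponse f) (hH : HessianOnKernel N f μ b)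
    (hb : IsReductionBasis N f v w) (h : IsReductionVia N f v w g W)
    (p q : (Fin m → ℝ) × ℝ) (i : Fin m) :
    fderiv ℝ (fderiv ℝ g) 0 p q i =
      b * (w i ⬝ᵥ ((∑ j, p.1 j • v j) * ∑ j, q.1 j • v j)) +
        crossing μ f * (p.2 * q.1 i + q.2 * p.1 i) := by
  rw [h.fderiv_fderiv_reduction hf hb, hH _ _ _ _ _ (hb.jac_sum _) (hb.jac_sum _) (hb.dot_jac i),
    IsReductionVia.dot_sum_eq hb, IsReductionVia.dot_sum_eq hb]

/-- If the reduced map has terms of degree exactly two, the factor `b` does not vanish. -/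
lemma ne_zero_of_hasOrder_two (hf : IsResponse f) (hH : HessianOnKernel N f μ b)
    (h2 : HasOrder N f 2) : b ≠ 0 := by
  rintro rfl
  obtain ⟨m, v, w, g, hb, ⟨W, hW, hW0, hWe⟩, -, hne⟩ := h2
  have h : IsReductionVia N f v w g W := ⟨hW, hW0, hWe⟩
  refine hne (ContinuousMultilinearMap.ext fun u => funext fun i => ?_)
  rw [iteratedFDeriv_two_state (h.contDiffAt_reduction hf) (h.fderiv_reduction hf hb),
    fderiv_fderiv_reduction_eq hf hH hb h]
  simp

lemma taylorForm_two_apply (hf : IsResponse f) (hH : HessianOnKernel N f μ b)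
    (hb : IsReductionBasis N f v w) (h : IsReductionVia N f v w g W) (u : Fin m → ℝ) (i : Fin m) :
    taylorForm 2 g u i =
      2⁻¹ * (b * (w i ⬝ᵥ ((∑ j, u j • v j) * ∑ j, u j • v j))) := by
  rw [taylorForm_two (h.contDiffAt_reduction hf) (h.fderiv_reduction hf hb), Pi.smul_apply,
    fderiv_fderiv_reduction_eq hf hH hb h]
  simp

lemma blowUp_eq (hf : IsResponse f) (hH : HessianOnKernel N f μ b)
    (hb : IsReductionBasis N f v w) (h : IsReductionVia N f v w g W) :
    blowUp (crossing μ f) (taylorForm 2 g) =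
      fun Y => (2⁻¹ : ℝ) • fderiv ℝ (fderiv ℝ g) 0 Y Y := by
  funext Y i
  simp only [blowUp, Pi.add_apply, Pi.smul_apply, smul_eq_mul]
  rw [taylorForm_two_apply hf hH hb h, fderiv_fderiv_reduction_eq hf hH hb h]
  ring

lemma fderiv_blowUp (hf : IsResponse f) (hH : HessianOnKernel N f μ b)
    (hb : IsReductionBasis N f v w) (h : IsReductionVia N f v w g W) (Y : (Fin m → ℝ) × ℝ) :
    fderiv ℝ (blowUp (crossing μ f) (taylorForm 2 g)) Y = fderiv ℝ (fderiv ℝ g) 0 Y := by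
  rw [blowUp_eq hf hH hb h]
  refine (hasFDerivAt_half_quadratic _ (fun X Y => ?_) Y).fderiv
  exact ((h.contDiffAt_reduction hf).isSymmSndFDerivAt (by simp; norm_cast)) X Y

/-- A zero of the reduced map is a zero of the field. -/
lemma field_eq_zero_of_reduction (hb : IsReductionBasis N f v w) {y : C → ℝ}
    (h1 : ∀ z, N.jac f z ⬝ᵥ y = 0) (h2 : ∀ i, w i ⬝ᵥ y = 0) : y = 0 := by
  have hy : y ∈ Submodule.span ℝ (Set.range w) :=
    (hb.2.2.2.1 y).2 fun z => by rw [dotProduct_comm]; exact h1 z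
  have : ∀ x ∈ Submodule.span ℝ (Set.range w), x ⬝ᵥ y = 0 := by
    intro x hx
    induction hx using Submodule.span_induction with
    | mem x hx => obtain ⟨i, rfl⟩ := hx; exact h2 i
    | zero => simp
    | add x z _ _ hx hz => rw [add_dotProduct, hx, hz, add_zero]
    | smul c x _ hx => rw [smul_dotProduct, hx, smul_zero]
  exact dotProduct_self_eq_zero.1 (this y hy)

/-- A nonzero kernel vector is not cancelled by the complementary part of the state, which is
orthogonal to the kernel. -/
lemma ne_zero_of_ker (hb : IsReductionBasis N f v w) {y : Fin m → ℝ} {x : C → ℝ} (hy : y ≠ 0)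
    (hx : ∀ z, N.jac f z = 0 → z ⬝ᵥ x = 0) : ∑ i, y i • v i + x ≠ 0 := by
  intro h
  have h1 := hx _ (hb.jac_sum y)
  have h2 : x = -∑ i, y i • v i := by rw [eq_neg_iff_add_eq_zero, add_comm]; exact h
  rw [h2, dotProduct_neg, neg_eq_zero] at h1
  exact hy (funext (Fintype.linearIndependent_iff.1 hb.1 y (dotProduct_self_eq_zero.1 h1)))

/-- The branch is the image of the curve of zeros of the reduced map in the direction `u` and the
parameter direction `η̃(u)`. -/
lemma exists_branch_of_nondegenerate (hf : IsResponse f) (hH : HessianOnKernel N f μ b)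
    (hb : IsReductionBasis N f v w) (h : IsReductionVia N f v w g W)
    (hiso : IsolatedOrigin N f) {u : Fin m → ℝ} (hu : u ⬝ᵥ u = 1)
    (hz : hTilde (crossing μ f) (taylorForm 2 g) u = 0)
    (hnd : IsNondegenerateZero (crossing μ f) (taylorForm 2 g) u) :
    ∃ δ β, IsBifurcationBranch N f δ β ∧
      Filter.Tendsto (fun z => z⁻¹ • (β z).1) (𝓝[>] 0) (𝓝 (∑ i, u i • v i)) := by
  set Y₀ : (Fin m → ℝ) × ℝ := (u, etaTilde (crossing μ f) (taylorForm 2 g) u) with hY₀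
  have hg := h.contDiffAt_reduction hf
  obtain ⟨φ, hφ, hφ0, hφz⟩ := exists_zero_curve (g := g) (hg.of_le (by norm_cast))
    (h.reduction_zero hf) (h.fderiv_reduction hf hb) (by simp)
    ((dotCLM u).comp (ContinuousLinearMap.fst ℝ _ ℝ)) Y₀ hu
    (by
      have : (2⁻¹ : ℝ) • fderiv ℝ (fderiv ℝ g) 0 Y₀ Y₀ = 0 := by
        rw [← congrFun (blowUp_eq hf hH hb h) Y₀]
        exact hz
      simpa using this)
    (fun Y hY hY' => by
      rw [← fderiv_blowUp hf hH hb h] at hY'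
      obtain ⟨h1, h2⟩ := hnd Y.1 Y.2 (by rw [dotProduct_comm]; exact hY) hY'
      exact Prod.ext h1 h2)
  have hψ0 : (fun z : ℝ => z • φ z) 0 = 0 := zero_smul ℝ _
  have hψ : Filter.Tendsto (fun z : ℝ => z • φ z) (𝓝 0) (𝓝 0) := by
    have h2 : ContinuousAt (fun z : ℝ => z • φ z) 0 := continuousAt_id.smul hφ.continuousAt
    simpa [ContinuousAt] using h2
  let β : ℝ → (C → ℝ) × ℝ := fun z => IsReductionVia.embed v W (z • φ z)
  have hβ0 : β 0 = 0 := by simp only [β, zero_smul, h.embed_zero]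
  have hβ : Filter.Tendsto β (𝓝 0) (𝓝 0) := by
    have := h.contDiffAt_embed.continuousAt.tendsto.comp hψ
    rwa [h.embed_zero] at this
  have hev1 : ∀ᶠ z in 𝓝 (0 : ℝ), DifferentiableAt ℝ φ z :=
    (hφ.eventually (by simp)).mono fun z hz => hz.differentiableAt one_ne_zero
  have hev2 : ∀ᶠ z in 𝓝 (0 : ℝ), DifferentiableAt ℝ (IsReductionVia.embed v W) (z • φ z) :=
    hψ.eventually (((h.contDiffAt_embed.of_le (by norm_cast : (1 : ℕ∞ω) ≤ ∞)).eventually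
      (by simp)).mono fun z hz => hz.differentiableAt one_ne_zero)
  have hev3 : ∀ᶠ z in 𝓝 (0 : ℝ), (φ z).1 ≠ 0 := by
    have : ContinuousAt (fun z => (φ z).1) 0 := hφ.continuousAt.fst
    refine this.eventually_ne ?_
    rw [hφ0]
    rintro (h0 : u = 0)
    simp [h0] at hu
  have hev4 : ∀ᶠ z in 𝓝 (0 : ℝ), (β z).1 ≠ 0 → N.field f ((β z).1, 0) ≠ 0 :=
    hβ.fst_nhds.eventually (eventually_nhdsWithin_iff.1 hiso)
  obtain ⟨δ, hδ, hball⟩ := Metric.eventually_nhds_iff_ball.1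
    (hev1.and (hev2.and (hev3.and (hev4.and (hφz.and (hψ.eventually h.eventually))))))
  have hmem : ∀ z ∈ Set.Ico 0 δ, z ∈ Metric.ball (0 : ℝ) δ := fun z hz => by
    rw [Real.ball_eq_Ioo]
    exact ⟨by linarith [hz.1], by linarith [hz.2]⟩
  refine ⟨δ, β, ⟨hδ, fun z hz => ?_, hβ0, fun z hz => ?_⟩, ?_⟩
  · obtain ⟨h1, h2, -⟩ := hball z (hmem z hz)
    have h3 : DifferentiableAt ℝ (fun z : ℝ => z • φ z) z := differentiableAt_id.smul h1
    exact (DifferentiableAt.comp z h2 h3).differentiableWithinAt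
  · obtain ⟨-, -, h3, h4, h5, h6⟩ := hball z (hmem z ⟨hz.1.le, hz.2⟩)
    have hfield : N.field f (β z) = 0 := by
      refine field_eq_zero_of_reduction hb h6.2.1 fun i => ?_
      have := h6.2.2 i
      rw [h5] at this
      exact this.symm
    have hne : (β z).1 ≠ 0 := ne_zero_of_ker hb
      (y := (z • φ z).1) (smul_ne_zero hz.1.ne' h3) h6.1
    -- the parameter cannot vanish, as the origin is isolated among the zeros at `λ = 0`
    refine ⟨fun hl => h4 hne ?_, hfield, hne⟩
    rw [← hl]
    exact hfield
  · have hd : HasDerivAt (fun z : ℝ => z • φ z) Y₀ 0 := by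
      have h1 : HasDerivAt (fun z : ℝ => z • φ z) ((0 : ℝ) • deriv φ 0 + (1 : ℝ) • φ 0) 0 :=
        (hasDerivAt_id (0 : ℝ)).smul (hφ.differentiableAt one_ne_zero).hasDerivAt
      rwa [zero_smul, zero_add, one_smul, hφ0] at h1
    have hd' : HasFDerivAt (IsReductionVia.embed v W)
        (fderiv ℝ (IsReductionVia.embed v W) 0) ((fun z : ℝ => z • φ z) 0) := by
      rw [hψ0]
      exact h.hasFDerivAt_embed.differentiableAt.hasFDerivAt
    have hd2 : HasDerivAt β (∑ i, u i • v i, Y₀.2) 0 := by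
      have := hd'.comp_hasDerivAt 0 hd
      rwa [h.fderiv_embed hf hb] at this
    have := (hasDerivAt_iff_tendsto_slope_zero.1 hd2).mono_left
      (nhdsWithin_mono 0 (s := Set.Ioi 0) fun z (hz : (0 : ℝ) < z) => hz.ne')
    have h2 := this.fst_nhds
    simp only [zero_add, hβ0, sub_zero, Prod.smul_fst] at h2
    exact h2

end Existence

/-! ### Synchrony of branches -/

section Synchrony

variable {C E : Type*} {ϑ : ℕ} [Fintype C] [Finite E] {N : RegularNetwork C E ϑ} {r : Setoid C}
  {f : ℝ × (Fin ϑ → ℝ) × ℝ → ℝ}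

lemma continuous_liftVec : Continuous (liftLin r) :=
  LinearMap.continuous_of_finiteDimensional _

/-- Zeros on the quotient lift to zeros on the network. -/
lemma isolatedOrigin_quotient (hf : IsResponse f) (hr : N.IsBalanced r)
    (h : IsolatedOrigin N f) : IsolatedOrigin (N.quotient r) f := by
  have hl : Filter.Tendsto (liftLin r) (𝓝[≠] 0) (𝓝[≠] 0) := by
    refine tendsto_nhdsWithin_iff.2 ⟨?_, ?_⟩
    · have := (continuous_liftVec (r := r)).tendsto 0
      rw [map_zero] at this
      exact this.mono_left nhdsWithin_le_nhds
    · filter_upwards [self_mem_nhdsWithin] with x hx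
      exact fun h0 => hx (liftVec_injective (h0.trans (map_zero _).symm))
  filter_upwards [hl.eventually h] with x hx h0
  refine hx ?_
  have := field_liftVec hr hf.symm x 0
  rw [h0] at this
  exact this

/-- A branch on `N/r` whose direction is in no polydiagonal of a balanced coloring that is
strictly coarser than `r` lifts to a branch on `N` with exactly synchrony `r`. -/
lemma supportsBranch_of_quotient (hf : IsResponse f) (hr : N.IsBalanced r) {δ : ℝ}
    {β : ℝ → (Quotient r → ℝ) × ℝ} (hβ : IsBifurcationBranch (N.quotient r) f δ β)
    {x : Quotient r → ℝ} (hx : Filter.Tendsto (fun z => z⁻¹ • (β z).1) (𝓝[>] 0) (𝓝 x))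
    (hsync : ∀ r', N.IsBalanced r' → r < r' → liftVec x ∉ polydiagonal r') :
    SupportsBranch N f r := by
  obtain ⟨hδ, hd, h0, hz⟩ := hβ
  refine ⟨δ, fun z => (liftLin r (β z).1, (β z).2), ⟨hδ, ?_, ?_, fun z hz' => ?_⟩,
    fun z _ => liftVec_mem_polydiagonal _, fun r' hr' hlt δ' hδ' => ?_⟩
  · exact ((LinearMap.toContinuousLinearMap (liftLin r)).differentiable.comp_differentiableOn
      hd.fst).prodMk hd.snd
  · simp [h0]
  · obtain ⟨h1, h2, h3⟩ := hz z hz'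
    refine ⟨h1, ?_, fun h => h3 (liftVec_injective (h.trans (map_zero _).symm))⟩
    have := field_liftVec hr hf.symm (β z).1 (β z).2
    rw [h2] at this
    exact this
  · by_contra! hcon
    refine hsync r' hr' hlt ?_
    have hclosed : IsClosed (polydiagonal r' : Set (C → ℝ)) :=
      Submodule.closed_of_finiteDimensional _
    have ht := ((continuous_liftVec (r := r)).tendsto x).comp hx
    refine hclosed.mem_of_tendsto ht ?_
    filter_upwards [Ioo_mem_nhdsGT hδ'.1] with z hz
    have := hcon z ⟨hz.1.le, hz.2⟩
    simp only [Function.comp_apply, map_smul]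
    exact Submodule.smul_mem _ _ this

/-- A kernel direction outside the polydiagonals of the `μ`-simple components is outside those of all
strictly coarser balanced colorings: such a coloring is coarser than a component, or `μ` is not an
eigenvalue of its quotient. -/
lemma notMem_polydiagonal_of_submaximal {μ : ℝ} {j : ℕ} {comp : Fin j → Setoid C}
    (hsub : IsSubmaximal N μ r j comp) {x : Quotient r → ℝ}
    (hx : (N.quotient r).adjacency.mulVec x = μ • x) (h0 : x ≠ 0)
    (hc : ∀ i, liftVec x ∉ polydiagonal (comp i)) (r' : Setoid C) (hr' : N.IsBalanced r')
    (hlt : r < r') : liftVec x ∉ polydiagonal r' := by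
  intro hmem
  obtain ⟨-, hr, -, -, -, h⟩ := hsub
  by_cases hex : ∃ i, comp i ≤ r'
  · obtain ⟨i, hi⟩ := hex
    exact hc i (polydiagonal_anti hi hmem)
  · push Not at hex
    rcases h r' hr' hlt (fun i hi => hex i hi.ge) with h | ⟨i, hi⟩
    · refine h (hasEigenvalue_quotient hr' ?_ hmem ?_)
      · rw [adjacency_mulVec_liftVec hr, hx]
        rfl
      · exact fun h => h0 (liftVec_injective (h.trans (map_zero (liftLin r)).symm))
    · exact hex i hi

end Synchrony

/-! ### Limit directions of branches that leave a polydiagonal -/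

section Direction

variable {C E : Type*} {ϑ : ℕ} [Fintype C] [Finite E] {N : RegularNetwork C E ϑ}
  {f : ℝ × (Fin ϑ → ℝ) × ℝ → ℝ} {v w : Fin 2 → C → ℝ} {s : Setoid C} {μ b : ℝ}

/-- On a polydiagonal the Jacobian restricts to an endomorphism, whose kernel and range are
complementary. -/
lemma exists_eq_smul_add_jac (hf : IsResponse f) (hb : IsReductionBasis N f v w)
    (hs : N.IsBalanced s) {p : Fin 2}
    (hker : ∀ u : Fin 2 → ℝ, ∑ i, u i • v i ∈ polydiagonal s → ∀ i ≠ p, u i = 0) {x : C → ℝ}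
    (hx : x ∈ polydiagonal s) :
    ∃ t : ℝ, ∃ y ∈ polydiagonal s, x = t • v p + N.jac f y := by
  let J : polydiagonal s →ₗ[ℝ] polydiagonal s :=
    (N.jac f).toLinearMap.restrict fun y hy => jac_mem_polydiagonal hf hs hy
  have hJ : ∀ y, (J y : C → ℝ) = N.jac f y := fun _ => rfl
  have hdisj : Disjoint (LinearMap.ker J) (LinearMap.range J) := by
    rw [Submodule.disjoint_def]
    rintro y hy ⟨z, rfl⟩
    have h1 : N.jac f (J z) = 0 := by rw [← hJ, LinearMap.mem_ker.1 hy]; rfl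
    obtain ⟨u, hu⟩ := (Submodule.mem_span_range_iff_exists_fun ℝ).1 ((hb.2.1 _).2 h1)
    have h2 : u = 0 := by
      ext i
      rw [← IsReductionVia.dot_sum_eq hb u i, hu, hJ]
      exact hb.dot_jac i _
    ext1
    rw [← hu, h2]
    simp
  have htop := Submodule.eq_top_of_disjoint _ _
    (by rw [add_comm, LinearMap.finrank_range_add_finrank_ker J]) hdisj
  have hmem : (⟨x, hx⟩ : polydiagonal s) ∈ LinearMap.ker J ⊔ LinearMap.range J := by
    rw [htop]; trivial
  obtain ⟨y, hy, -, ⟨z, rfl⟩, hyz⟩ := Submodule.mem_sup.1 hmem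
  have h1 : N.jac f y = 0 := by rw [← hJ, LinearMap.mem_ker.1 hy]; rfl
  obtain ⟨u, hu⟩ := (Submodule.mem_span_range_iff_exists_fun ℝ).1 ((hb.2.1 _).2 h1)
  have hu1 := hker u (by rw [hu]; exact y.2)
  refine ⟨u p, z, z.2, ?_⟩
  rw [Fintype.sum_eq_single p fun i hi => by rw [hu1 i hi, zero_smul]] at hu
  rw [hu, ← hJ]
  exact (congrArg Subtype.val hyz).symm

/-- The polydiagonal is the sum of the line of `v p` and of a part of the range of the Jacobian, both of
which are annihilated by the other dual vectors. -/
lemma dot_eq_zero_of_mem_polydiagonal (hf : IsResponse f) (hb : IsReductionBasis N f v w)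
    (hs : N.IsBalanced s) {p i : Fin 2} (hi : i ≠ p)
    (hker : ∀ u : Fin 2 → ℝ, ∑ i, u i • v i ∈ polydiagonal s → ∀ i ≠ p, u i = 0) {x : C → ℝ}
    (hx : x ∈ polydiagonal s) : w i ⬝ᵥ x = 0 := by
  obtain ⟨t, y, -, rfl⟩ := exists_eq_smul_add_jac hf hb hs hker hx
  rw [dotProduct_add, hb.dot_jac, dotProduct_smul, hb.2.2.2.2, if_neg hi]
  simp

lemma exists_eq_smul_add_of_jac_mem (hf : IsResponse f) (hb : IsReductionBasis N f v w)
    (hs : N.IsBalanced s) (hv : v 0 ∈ polydiagonal s)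
    (hker : ∀ u : Fin 2 → ℝ, ∑ i, u i • v i ∈ polydiagonal s → ∀ i ≠ 0, u i = 0) {x : C → ℝ}
    (hx : N.jac f x ∈ polydiagonal s) :
    ∃ t : ℝ, ∃ y ∈ polydiagonal s, x = t • v 1 + y := by
  obtain ⟨t, y, hy, hxy⟩ := exists_eq_smul_add_jac hf hb hs hker hx
  have ht : t = 0 := by
    have := congrArg (fun z => w 0 ⬝ᵥ z) hxy
    simp only [dotProduct_add, hb.dot_jac, dotProduct_smul, hb.2.2.2.2] at this
    simpa using this.symm
  have h1 : N.jac f (x - y) = 0 := by rw [map_sub, hxy, ht]; simp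
  obtain ⟨u, hu⟩ := (Submodule.mem_span_range_iff_exists_fun ℝ).1 ((hb.2.1 _).2 h1)
  rw [Fin.sum_univ_two] at hu
  refine ⟨u 1, u 0 • v 0 + y, Submodule.add_mem _ (Submodule.smul_mem _ _ hv) hy, ?_⟩
  rw [← add_assoc, add_comm (u 1 • v 1), hu]
  abel

/-- Second order expansion of the difference of the field at two states. -/
lemma field_sub_isLittleO (hf : IsResponse f) {ι : Type*} {l : Filter ι} {x p : ι → C → ℝ}
    {t : ι → ℝ} (hx : Filter.Tendsto x l (𝓝 0))
    (ht : Filter.Tendsto t l (𝓝 0)) {K : ℝ} (hK : ∀ᶠ z in l, ‖p z‖ ≤ K * ‖x z‖) :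
    (fun z => N.field f (x z, t z) - N.field f (p z, t z) - N.jac f (x z - p z) -
      (2⁻¹ : ℝ) • fderiv ℝ (fderiv ℝ (N.field f)) 0 (x z + p z, 2 * t z) (x z - p z, 0)) =o[l]
      fun z => ‖(x z, t z)‖ * ‖x z - p z‖ := by
  have hF := contDiffAt_field N hf.smooth
  set D := fderiv ℝ (fderiv ℝ (N.field f)) 0 with hD
  have hsymm : ∀ X Y, D X Y = D Y X := fun X Y =>
    (hF.isSymmSndFDerivAt (by simp; norm_cast)) X Y
  have hK1 : 0 < max 1 K := lt_max_of_lt_left one_pos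
  rw [Asymptotics.isLittleO_iff]
  intro c hc
  obtain ⟨δ, hδ, hT⟩ := taylor_two_remainder (hF.of_le (by norm_cast)) (div_pos hc hK1)
  have hR : Filter.Tendsto (fun z => max 1 K * ‖(x z, t z)‖) l (𝓝 0) := by
    have : Filter.Tendsto (fun z => (x z, t z)) l (𝓝 0) := hx.prodMk_nhds ht
    simpa using this.norm.const_mul (max 1 K)
  filter_upwards [hK, hR.eventually_lt_const hδ] with z hz hz'
  have hX : ‖(x z, t z)‖ ≤ max 1 K * ‖(x z, t z)‖ :=
    le_mul_of_one_le_left (norm_nonneg _) (le_max_left _ _)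
  have hP : ‖(p z, t z)‖ ≤ max 1 K * ‖(x z, t z)‖ := by
    rw [Prod.norm_def]
    refine max_le ?_ ((le_max_right ‖x z‖ _).trans hX)
    refine hz.trans (mul_le_mul (le_max_right _ _) (le_max_left _ _) (norm_nonneg _) hK1.le)
  have h1 := hT _ hz' (x z, t z) (p z, t z) hX hP
  have hsub : ((x z, t z) : (C → ℝ) × ℝ) - (p z, t z) = (x z - p z, 0) := by simp
  have hadd : ((x z, t z) : (C → ℝ) × ℝ) + (p z, t z) = (x z + p z, 2 * t z) := by
    rw [Prod.mk_add_mk, two_mul]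
  have hn : ‖((x z - p z, 0) : (C → ℝ) × ℝ)‖ = ‖x z - p z‖ := by simp [Prod.norm_def]
  rw [hsub, hn] at h1
  rw [norm_mul, norm_norm, norm_norm]
  refine le_trans (le_of_eq ?_) (h1.trans (le_of_eq ?_))
  · congr 1
    have hq : D (x z + p z, 2 * t z) (x z - p z, 0) =
        D (x z, t z) (x z, t z) - D (p z, t z) (p z, t z) := by
      rw [← hadd, ← hsub]
      simp only [map_add, map_sub, add_apply]
      rw [hsymm (p z, t z) (x z, t z)]
      abel
    have hj : N.jac f (x z - p z) = fderiv ℝ (N.field f) 0 (x z, t z) -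
        fderiv ℝ (N.field f) 0 (p z, t z) := by
      rw [← map_sub, hsub, fderiv_field_eq_jac N hf]
    rw [hq, hj, smul_sub]
    abel
  · field_simp

lemma exists_ultrafilter_limit {ι V : Type*} [NormedAddCommGroup V] [NormedSpace ℝ V]
    [FiniteDimensional ℝ V] (U : Ultrafilter ι) (y : ι → V) {K : ℝ} (h : ∀ i, ‖y i‖ ≤ K) :
    ∃ y₀, Filter.Tendsto y U (𝓝 y₀) := by
  obtain ⟨y₀, -, hy₀⟩ := (isCompact_closedBall (0 : V) K).ultrafilter_le_nhds (U.map y) (by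
    rw [Filter.le_principal_iff]
    exact Filter.mem_map.2 (Filter.Eventually.of_forall fun i => by simpa using h i))
  exact ⟨y₀, hy₀⟩

lemma norm_inv_smul_le_one {V : Type*} [NormedAddCommGroup V] [NormedSpace ℝ V] (x : V) :
    ‖‖x‖⁻¹ • x‖ ≤ 1 := by
  rw [norm_smul, norm_inv, norm_norm]
  exact inv_mul_le_one

/-- Let a family of zeros of the field converge to the origin outside the polydiagonal of `s`. Its
limit directions are zeros `u` of the blown-up map. If the limit direction lies in the polydiagonal,
then the limit of the directions transversal to the polydiagonal is in the kernel of the derivative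
of the blown-up map. -/
lemma exists_limit_direction (hf : IsResponse f) (hH : HessianOnKernel N f μ b)
    (ha : crossing μ f ≠ 0) (hb : IsReductionBasis N f v w)
    (hs : N.IsBalanced s) (hv : v 0 ∈ polydiagonal s)
    (hker : ∀ u : Fin 2 → ℝ, ∑ i, u i • v i ∈ polydiagonal s → ∀ i ≠ 0, u i = 0)
    {ι : Type*} {l : Filter ι} [l.NeBot] {x : ι → C → ℝ} {t : ι → ℝ}
    (hx : Filter.Tendsto x l (𝓝 0)) (ht : Filter.Tendsto t l (𝓝 0))
    (hz : ∀ᶠ z in l, N.field f (x z, t z) = 0) (hxs : ∀ᶠ z in l, x z ∉ polydiagonal s) :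
    ∃ (u : Fin 2 → ℝ) (η : ℝ), u ≠ 0 ∧
      (∀ i, η * crossing μ f * u i +
        2⁻¹ * (b * (w i ⬝ᵥ ((∑ j, u j • v j) * ∑ j, u j • v j))) = 0) ∧
      (u 1 = 0 → η * crossing μ f + b * (u 0 * (w 1 ⬝ᵥ (v 0 * v 1))) = 0) := by
  -- along an ultrafilter all bounded quantities converge
  obtain ⟨U, hU⟩ := Ultrafilter.exists_le l
  replace hx := hx.mono_left hU
  replace ht := ht.mono_left hU
  replace hz := hz.filter_mono hU
  replace hxs := hxs.filter_mono hU
  set D := fderiv ℝ (fderiv ℝ (N.field f)) 0 with hD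
  have hDc : Continuous fun q : ((C → ℝ) × ℝ) × ((C → ℝ) × ℝ) => D q.1 q.2 := by fun_prop
  -- a linear projection onto the polydiagonal
  obtain ⟨π, hπ⟩ := (polydiagonal s).subtype.exists_leftInverse_of_injective
    (Submodule.ker_subtype _)
  let P : (C → ℝ) →L[ℝ] (C → ℝ) :=
    LinearMap.toContinuousLinearMap ((polydiagonal s).subtype ∘ₗ π)
  have hPmem : ∀ y, P y ∈ polydiagonal s := fun y => (π y).2
  have hPid : ∀ y ∈ polydiagonal s, P y = y := fun y hy =>
    congrArg Subtype.val (congrArg (fun T => T ⟨y, hy⟩) hπ)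
  have hx0 : ∀ᶠ z in (U : Filter ι), x z ≠ 0 := hxs.mono fun z hz h0 => hz (by
    rw [h0]; exact Submodule.zero_mem _)
  have hd0 : ∀ᶠ z in (U : Filter ι), x z - P (x z) ≠ 0 := hxs.mono fun z hz h0 => hz (by
    rw [sub_eq_zero.1 h0]; exact hPmem _)
  -- limits of the normalized quantities
  let n : ι → ℝ := fun z => ‖(x z, t z)‖
  let d : ι → C → ℝ := fun z => x z - P (x z)
  obtain ⟨ξ, hξ⟩ := exists_ultrafilter_limit U (fun z => ‖x z‖⁻¹ • x z)
    (fun z => norm_inv_smul_le_one _)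
  obtain ⟨e, he⟩ := exists_ultrafilter_limit U (fun z => ‖d z‖⁻¹ • d z)
    (fun z => norm_inv_smul_le_one _)
  obtain ⟨Z, hZ⟩ := exists_ultrafilter_limit U (fun z => (n z)⁻¹ • (x z, t z))
    (fun z => norm_inv_smul_le_one _)
  have hn0 : ∀ᶠ z in (U : Filter ι), n z ≠ 0 := hx0.mono fun z hz h0 => hz
    (congrArg Prod.fst (norm_eq_zero.1 h0))
  have hn : Filter.Tendsto n U (𝓝 0) := by
    have : Filter.Tendsto (fun z => (x z, t z)) U (𝓝 0) := hx.prodMk_nhds ht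
    simpa only [norm_zero] using this.norm
  have hξ1 : ‖ξ‖ = 1 := by
    refine tendsto_nhds_unique hξ.norm (tendsto_const_nhds.congr' ?_)
    filter_upwards [hx0] with z hz
    rw [norm_smul, norm_inv, norm_norm, inv_mul_cancel₀ (norm_ne_zero_iff.2 hz)]
  have he1 : ‖e‖ = 1 := by
    refine tendsto_nhds_unique he.norm (tendsto_const_nhds.congr' ?_)
    filter_upwards [hd0] with z hz
    rw [norm_smul, norm_inv, norm_norm, inv_mul_cancel₀ (norm_ne_zero_iff.2 hz)]
  have hZ1 : ‖Z‖ = 1 := by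
    refine tendsto_nhds_unique hZ.norm (tendsto_const_nhds.congr' ?_)
    filter_upwards [hn0] with z hz
    rw [norm_smul, norm_inv, norm_norm, inv_mul_cancel₀ hz]
  -- the state part of `Z` is a multiple of `ξ`
  have hZξ : Z.1 = ‖Z.1‖ • ξ := by
    refine tendsto_nhds_unique hZ.fst_nhds ((hZ.fst_nhds.norm.smul hξ).congr' ?_)
    filter_upwards [hx0] with z hz
    simp only [Prod.smul_fst, norm_smul, norm_inv, smul_smul]
    congr 1
    have : ‖n z‖ = n z := norm_norm _
    rw [this, mul_assoc, mul_inv_cancel₀ (norm_ne_zero_iff.2 hz), mul_one]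
  have hPe : P e = 0 := by
    refine tendsto_nhds_unique ((P.continuous.tendsto e).comp he)
      (tendsto_const_nhds.congr fun z => ?_)
    simp only [Function.comp_apply, d, map_smul, map_sub, hPid _ (hPmem _), sub_self, smul_zero]
  -- the expansions at `(x, t)` relative to `(0, t)` and relative to `(P x, t)`
  have hgen : ∀ (p : ι → C → ℝ) (K : ℝ) (θ : C → ℝ) (q : C → ℝ),
      (∀ᶠ z in (U : Filter ι), ‖p z‖ ≤ K * ‖x z‖) →
      Filter.Tendsto (fun z => ‖x z - p z‖⁻¹ • (x z - p z)) U (𝓝 θ) →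
      Filter.Tendsto (fun z => (n z)⁻¹ • p z) U (𝓝 q) →
      ∀ T : (C → ℝ) →L[ℝ] ℝ, (∀ z, T (N.field f (p z, t z)) = 0) →
        T (N.jac f θ) = 0 ∧
          ((∀ y, T (N.jac f y) = 0) → T (D (Z.1 + q, 2 * Z.2) (θ, 0)) = 0) := by
    intro p K θ q hK hθ hq T hT
    have h1 := (field_sub_isLittleO (N := N) hf hx ht hK).tendsto_inv_smul_nhds_zero
    have h2 := (T.continuous.tendsto 0).comp h1
    rw [map_zero] at h2
    have h3 : Filter.Tendsto (fun z => (2⁻¹ : ℝ) • T (D ((n z)⁻¹ • x z + (n z)⁻¹ • p z,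
        2 * ((n z)⁻¹ • t z)) (‖x z - p z‖⁻¹ • (x z - p z), 0))) U
        (𝓝 ((2⁻¹ : ℝ) • T (D (Z.1 + q, 2 * Z.2) (θ, 0)))) := by
      refine Filter.Tendsto.const_smul ((T.continuous.tendsto _).comp ?_) _
      exact (hDc.tendsto _).comp (((hZ.fst_nhds.add hq).prodMk_nhds
        (hZ.snd_nhds.const_mul 2)).prodMk_nhds (hθ.prodMk_nhds tendsto_const_nhds))
    have h4 := (h2.add h3).neg
    rw [zero_add] at h4
    have h5 : Filter.Tendsto (fun z => (n z)⁻¹ • T (N.jac f (‖x z - p z‖⁻¹ • (x z - p z)))) U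
        (𝓝 (-((2⁻¹ : ℝ) • T (D (Z.1 + q, 2 * Z.2) (θ, 0))))) := ?_
    · refine ⟨?_, fun hTJ => ?_⟩
      · have h6 := hn.smul h5
        rw [zero_smul] at h6
        refine tendsto_nhds_unique (((T.comp (N.jac f)).continuous.tendsto θ).comp hθ)
          (h6.congr' ?_)
        filter_upwards [hn0] with z hz
        rw [smul_inv_smul₀ hz]
        rfl
      · simp only [hTJ, smul_zero] at h5
        have := tendsto_nhds_unique h5 tendsto_const_nhds
        simpa using this
    refine h4.congr' ?_
    filter_upwards [hz] with z hz
    have hmk : ((n z)⁻¹ • x z + (n z)⁻¹ • p z, 2 * ((n z)⁻¹ • t z)) =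
        (n z)⁻¹ • (x z + p z, 2 * t z) := by
      rw [Prod.smul_mk, smul_add, smul_eq_mul, smul_eq_mul]
      congr 1
      ring
    have hmk' : ((‖x z - p z‖⁻¹ • (x z - p z), 0) : (C → ℝ) × ℝ) =
        ‖x z - p z‖⁻¹ • (x z - p z, 0) := by
      rw [Prod.smul_mk, smul_zero]
    rw [hmk, hmk']
    simp only [Function.comp_apply, hz, map_smul, map_sub, smul_apply, hT z, smul_sub,
      map_zero, mul_inv, smul_smul, n]
    module
  -- the direction `ξ` is in the kernel, and a zero of the blown-up map
  have hgenξ := hgen (fun _ => 0) 0 ξ 0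
    (Filter.Eventually.of_forall fun z => by simp) (by simpa using hξ) (by simp)
  have hJξ : N.jac f ξ = 0 := funext fun c =>
    (hgenξ (ContinuousLinearMap.proj c) fun z => by rw [field_zero N hf]; simp).1
  obtain ⟨u, hu⟩ := (Submodule.mem_span_range_iff_exists_fun ℝ).1 ((hb.2.1 _).2 hJξ)
  have hwξ : ∀ i, w i ⬝ᵥ ξ = u i := fun i => by
    rw [← hu, IsReductionVia.dot_sum_eq hb]
  have hu0 : u ≠ 0 := by
    rintro rfl
    rw [← hu] at hξ1
    simp at hξ1
  set k := ‖Z.1‖ with hk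
  have hJZ : N.jac f Z.1 = 0 := by rw [hZξ, map_smul, hJξ, smul_zero]
  have heq : ∀ i, b * (k * (w i ⬝ᵥ (ξ * ξ))) + crossing μ f * (2 * Z.2 * u i) = 0 := by
    intro i
    have h1 := (hgenξ (dotCLM (w i)) fun z => by rw [field_zero N hf, map_zero]).2
      fun y => hb.dot_jac i y
    rw [dotCLM_apply, add_zero, hH _ _ _ _ _ hJZ hJξ (hb.dot_jac i), hZξ, smul_mul_assoc,
      dotProduct_smul, hwξ] at h1
    simpa using h1
  -- the state is not negligible against the parameter, as the crossing speed is nonzero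
  have hk0 : k ≠ 0 := by
    intro h0
    have h1 : ∀ i, Z.2 * u i = 0 := fun i => by
      have := heq i
      rw [h0, zero_mul, mul_zero, zero_add] at this
      have h2 := (mul_eq_zero.1 this).resolve_left ha
      linarith
    have hZ2 : Z.2 ≠ 0 := by
      intro h2
      have : Z = 0 := Prod.ext (norm_eq_zero.1 h0) h2
      rw [this, norm_zero] at hZ1
      exact zero_ne_one hZ1
    exact hu0 (funext fun i => (mul_eq_zero.1 (h1 i)).resolve_left hZ2)
  refine ⟨u, Z.2 / k, hu0, fun i => ?_, fun hu1 => ?_⟩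
  · rw [hu]
    have := heq i
    field_simp
    linarith
  -- the transversal direction `e`
  rw [Fin.sum_univ_two, hu1, zero_smul, add_zero] at hu
  have hξs : ξ ∈ polydiagonal s := by
    rw [← hu]; exact Submodule.smul_mem _ _ hv
  have hZs : Z.1 ∈ polydiagonal s := by
    rw [hZξ]; exact Submodule.smul_mem _ _ hξs
  have hgene := hgen (fun z => P (x z)) ‖P‖ e (P Z.1)
    (Filter.Eventually.of_forall fun z => P.le_opNorm _) he
    (((P.continuous.tendsto _).comp hZ.fst_nhds).congr fun z => by
      simp only [Function.comp_apply, Prod.smul_fst, map_smul])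
  have hJe : N.jac f e ∈ polydiagonal s := by
    have h1 : N.jac f e - P (N.jac f e) = 0 := funext fun c =>
      (hgene ((ContinuousLinearMap.proj c).comp (ContinuousLinearMap.id ℝ (C → ℝ) - P))
        fun z => by
          have := hPid _ (field_mem_polydiagonal hs hf.symm (hPmem (x z)) (t z))
          simp [this]).1
    rw [sub_eq_zero.1 h1]
    exact hPmem _
  obtain ⟨c, y, hy, hcy⟩ := exists_eq_smul_add_of_jac_mem hf hb hs hv hker hJe
  have hc : c ≠ 0 := by
    rintro rfl
    rw [zero_smul, zero_add] at hcy
    rw [hcy, hPid y hy] at hPe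
    rw [hcy, hPe, norm_zero] at he1
    exact zero_ne_one he1
  have h1 := (hgene (dotCLM (w 1)) fun z => by
    rw [dotCLM_apply]
    exact dot_eq_zero_of_mem_polydiagonal hf hb hs one_ne_zero hker
      (field_mem_polydiagonal hs hf.symm (hPmem (x z)) (t z))).2 fun y => hb.dot_jac 1 y
  have hJv : N.jac f (v 1) = 0 := (hb.2.1 _).1 (Submodule.subset_span ⟨1, rfl⟩)
  have hsplit : ((e, 0) : (C → ℝ) × ℝ) = c • (v 1, 0) + (y, 0) := by
    rw [hcy]; simp
  rw [dotCLM_apply, hPid _ hZs, hsplit, map_add, map_smul, dotProduct_add, dotProduct_smul,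
    dot_eq_zero_of_mem_polydiagonal hf hb hs one_ne_zero hker
      (hessian_mem_polydiagonal hf hs (Submodule.add_mem _ hZs hZs) hy _ _), add_zero,
    smul_eq_zero_iff_right hc, hH _ _ _ _ _ (by rw [map_add, hJZ, add_zero]) hJv (hb.dot_jac 1),
    hZξ, ← hu, add_mul, smul_mul_assoc, smul_mul_assoc] at h1
  simp only [dotProduct_add, dotProduct_smul, hb.2.2.2.2, smul_eq_mul, if_true] at h1
  field_simp
  linarith

end Direction

/-! ### Genericity of a nonzero crossing speed and of a nonzero derivative in the inputs -/

section Genericity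

variable {ϑ : ℕ} {μ : ℝ} {f : ℝ × (Fin ϑ → ℝ) × ℝ → ℝ}

lemma exists_jet_functional_ne {V : Type*} [NormedAddCommGroup V] [NormedSpace ℝ V] {f : V → ℝ}
    {k : ℕ} (e : Fin k → V) (hf : ContDiffAt ℝ ∞ f 0) (h : iteratedFDeriv ℝ k f 0 e ≠ 0) :
    ∃ ε > 0, ∀ f' : V → ℝ, ContDiffAt ℝ ∞ f' 0 → ‖iteratedFDeriv ℝ k (f' - f) 0‖ < ε →
      iteratedFDeriv ℝ k f' 0 e ≠ 0 := by
  have hpos : 0 < ∏ i, ‖e i‖ + 1 := by positivity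
  refine ⟨|iteratedFDeriv ℝ k f 0 e| / (∏ i, ‖e i‖ + 1), div_pos (abs_pos.2 h) hpos,
    fun f' hf' hlt h0 => ?_⟩
  have h1 := (iteratedFDeriv ℝ k (f' - f) 0).le_opNorm e
  rw [iteratedFDeriv_sub_apply (hf'.of_le (by exact_mod_cast le_top))
    (hf.of_le (by exact_mod_cast le_top)), sub_apply, h0, zero_sub,
    norm_neg, Real.norm_eq_abs, ← iteratedFDeriv_sub_apply (hf'.of_le (by exact_mod_cast le_top))
    (hf.of_le (by exact_mod_cast le_top))] at h1
  rw [lt_div_iff₀ hpos] at hlt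
  have h2 : ‖iteratedFDeriv ℝ k (f' - f) 0‖ * ∏ i, ‖e i‖ ≤
      ‖iteratedFDeriv ℝ k (f' - f) 0‖ * (∏ i, ‖e i‖ + 1) := by
    gcongr
    linarith
  linarith

lemma crossing_eq_iteratedFDeriv (hf : ContDiffAt ℝ ∞ f 0) :
    crossing μ f = iteratedFDeriv ℝ 2 f 0
      ![(0, 0, 1), (1, if h : 0 < ϑ then Pi.single ⟨0, h⟩ μ else 0, 0)] := by
  rw [iteratedFDeriv_two_apply, crossing, deriv_dSelf hf, deriv_dInput hf]
  simp only [Matrix.cons_val_zero, Matrix.cons_val_one]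
  split_ifs with h
  · rw [← smul_eq_mul, ← map_smul, ← map_add]
    congr 1
    simp [← Pi.single_smul]
  · simp

lemma dInput_eq_iteratedFDeriv (h : 0 < ϑ) :
    dInput f 0 = iteratedFDeriv ℝ 1 f 0 fun _ => (0, Pi.single ⟨0, h⟩ 1, 0) := by
  rw [iteratedFDeriv_one_apply, dInput, dif_pos h]
  rfl

/-- A perturbation inside `bifClass` that moves both the crossing speed and, if there are inputs, the
derivative with respect to the inputs. -/
def perturbation (ϑ : ℕ) (μ : ℝ) (p : ℝ × (Fin ϑ → ℝ) × ℝ) : ℝ :=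
  p.2.2 * p.1 + (if 0 < ϑ then 1 else 0) * (∑ i, p.2.1 i - μ * p.1)

lemma contDiff_perturbation : ContDiff ℝ ∞ (perturbation ϑ μ) := by
  unfold perturbation
  fun_prop

lemma fderiv_perturbation (l : ℝ) (y₀ : ℝ) (y : Fin ϑ → ℝ) (t : ℝ) :
    fderiv ℝ (perturbation ϑ μ) (0, 0, l) (y₀, y, t) =
      l * y₀ + (if 0 < ϑ then 1 else 0) * (∑ i, y i - μ * y₀) := by
  have h1 : HasDerivAt (fun z : ℝ => perturbation ϑ μ ((0, 0, l) + z • (y₀, y, t)))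
      (l * y₀ + (if 0 < ϑ then 1 else 0) * (∑ i, y i - μ * y₀)) 0 := by
    have : (fun z : ℝ => perturbation ϑ μ ((0, 0, l) + z • (y₀, y, t))) = fun z =>
        z * (l * y₀ + (if 0 < ϑ then 1 else 0) * (∑ i, y i - μ * y₀)) + z * z * (t * y₀) := by
      funext z
      simp only [perturbation, Prod.smul_mk, Prod.mk_add_mk, zero_add, smul_eq_mul, Pi.smul_apply,
        ← Finset.mul_sum]
      ring
    rw [this]
    have h2 := ((hasDerivAt_id (0 : ℝ)).mul_const
      (l * y₀ + (if 0 < ϑ then 1 else 0) * (∑ i, y i - μ * y₀))).add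
      (((hasDerivAt_id (0 : ℝ)).mul (hasDerivAt_id (0 : ℝ))).mul_const (t * y₀))
    refine h2.congr_deriv ?_
    simp
  have h3 := ((contDiff_perturbation (ϑ := ϑ) (μ := μ)).differentiable (by simp)
    (0, 0, l)).hasFDerivAt.hasLineDerivAt (y₀, y, t)
  exact h3.unique h1

lemma dSelf_perturbation (l : ℝ) :
    dSelf (perturbation ϑ μ) l = l - (if 0 < ϑ then 1 else 0) * μ := by
  rw [dSelf, fderiv_perturbation]
  simp
  ring

lemma dInput_perturbation (l : ℝ) : dInput (perturbation ϑ μ) l = if 0 < ϑ then 1 else 0 := by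
  unfold dInput
  split_ifs with h
  · rw [fderiv_perturbation]
    simp [h]
  · rfl

lemma crossing_perturbation : crossing μ (perturbation ϑ μ) = 1 := by
  have h1 : dSelf (perturbation ϑ μ) = fun l => l - (if 0 < ϑ then 1 else 0) * μ :=
    funext dSelf_perturbation
  have h2 : dInput (perturbation ϑ μ) = fun _ => if 0 < ϑ then 1 else 0 := funext dInput_perturbation
  rw [crossing, h1, h2, deriv_const, mul_zero, add_zero, deriv_sub_const]
  exact deriv_id 0

lemma fderiv_add_smul_perturbation (hf : ContDiffAt ℝ ∞ f 0) (t : ℝ) :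
    fderiv ℝ (f + t • perturbation ϑ μ) 0 = fderiv ℝ f 0 + t • fderiv ℝ (perturbation ϑ μ) 0 := by
  have hd : DifferentiableAt ℝ (perturbation ϑ μ) 0 :=
    contDiff_perturbation.differentiable (by simp) 0
  rw [fderiv_add (hf.differentiableAt (by simp)) (hd.const_smul t), fderiv_const_smul hd]

lemma dInput_add_smul_perturbation (hf : ContDiffAt ℝ ∞ f 0) (t : ℝ) :
    dInput (f + t • perturbation ϑ μ) 0 = dInput f 0 + t * dInput (perturbation ϑ μ) 0 := by
  unfold dInput
  split_ifs with h
  · have := fderiv_add_smul_perturbation (μ := μ) hf t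
    exact congrArg (fun T => T (0, Pi.single ⟨0, h⟩ 1, 0)) this
  · simp

lemma add_smul_perturbation_mem (hf : f ∈ bifClass ϑ μ) (t : ℝ) :
    f + t • perturbation ϑ μ ∈ bifClass ϑ μ := by
  have hs := contDiffAt_of_mem_bifClass hf
  obtain ⟨⟨U, hU, hfU⟩, hsym, h0, hμ⟩ := hf
  refine ⟨⟨U, hU, hfU.add (contDiff_perturbation.const_smul t).contDiffOn⟩, fun σ x₀ x l => ?_,
    fun l => ?_, ?_⟩
  · simp only [Pi.add_apply, Pi.smul_apply, hsym, perturbation, Function.comp_apply,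
      Equiv.sum_comp σ x]
  · simp [h0, perturbation]
  · have h1 : dSelf (f + t • perturbation ϑ μ) 0 = dSelf f 0 + t * dSelf (perturbation ϑ μ) 0 := by
      have := fderiv_add_smul_perturbation (μ := μ) hs t
      exact congrArg (fun T => T (1, 0, 0)) this
    rw [h1, dInput_add_smul_perturbation hs, dSelf_perturbation, dInput_perturbation]
    linear_combination hμ

lemma crossing_add_smul_perturbation (hf : ContDiffAt ℝ ∞ f 0) (t : ℝ) :
    crossing μ (f + t • perturbation ϑ μ) = crossing μ f + t := by
  have hc : ContDiffAt ℝ ∞ (perturbation ϑ μ) 0 := contDiff_perturbation.contDiffAt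
  have hc' : ContDiffAt ℝ ∞ (t • perturbation ϑ μ) 0 := hc.const_smul t
  have h2 : ((2 : ℕ) : ℕ∞ω) ≤ ∞ := by norm_cast
  have hadd : ContDiffAt ℝ ∞ (f + t • perturbation ϑ μ) 0 := hf.add hc'
  rw [crossing_eq_iteratedFDeriv hadd, crossing_eq_iteratedFDeriv hf,
    iteratedFDeriv_add_apply (hf.of_le h2)
      (hc'.of_le h2),
    iteratedFDeriv_const_smul_apply (hc.of_le h2),
    add_apply, smul_apply,
    ← crossing_eq_iteratedFDeriv hc, crossing_perturbation, smul_eq_mul, mul_one]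

lemma exists_jet_bound {V : Type*} [NormedAddCommGroup V] [NormedSpace ℝ V]
    [FiniteDimensional ℝ V] {p : V → ℝ} (hp : ContDiff ℝ ∞ p) (n : ℕ) (R : ℝ) :
    ∃ M > 0, ∀ i ≤ n, ∀ x, ‖x‖ ≤ R → ‖iteratedFDeriv ℝ i p x‖ ≤ M := by
  have h : ∀ i : ℕ, ∃ M, ∀ x ∈ Metric.closedBall (0 : V) R, ‖iteratedFDeriv ℝ i p x‖ ≤ M :=
    fun i => (isCompact_closedBall 0 R).exists_bound_of_continuousOn
      (hp.continuous_iteratedFDeriv (by exact_mod_cast le_top)).continuousOn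
  choose M hM using h
  refine ⟨∑ i ∈ Finset.range (n + 1), |M i| + 1, by positivity, fun i hi x hx => ?_⟩
  have h1 := hM i x (by simpa using hx)
  have h2 : |M i| ≤ ∑ i ∈ Finset.range (n + 1), |M i| :=
    Finset.single_le_sum (f := fun i => |M i|) (fun _ _ => abs_nonneg _)
      (Finset.mem_range.2 (by omega))
  linarith [le_abs_self (M i)]

/-- The crossing speed and the derivative with respect to the inputs are nonzero on an open dense set:
they are evaluations of jets, and adding a small multiple of `perturbation` makes them nonzero. -/
lemma Generically.and_nondegenerate {P : (ℝ × (Fin ϑ → ℝ) × ℝ → ℝ) → Prop}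
    (h : Generically ϑ μ P) : Generically ϑ μ fun f =>
      P f ∧ f ∈ bifClass ϑ μ ∧ crossing μ f ≠ 0 ∧ (0 < ϑ → dInput f 0 ≠ 0) := by
  obtain ⟨G, hG, hopen, hdense, hP⟩ := h
  refine ⟨{f | f ∈ G ∧ crossing μ f ≠ 0 ∧ (0 < ϑ → dInput f 0 ≠ 0)}, fun f hf => hG hf.1, ?_, ?_,
    fun f hf => ⟨hP f hf.1, hG hf.1, hf.2⟩⟩
  · rintro f ⟨hfG, hc, hi⟩
    have hf := contDiffAt_of_mem_bifClass (hG hfG)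
    obtain ⟨n, ε, hε, hn⟩ := hopen f hfG
    rw [crossing_eq_iteratedFDeriv hf] at hc
    obtain ⟨ε₂, hε₂, h₂⟩ := exists_jet_functional_ne _ hf hc
    obtain ⟨ε₁, hε₁, h₁⟩ : ∃ ε > 0, ∀ f' : ℝ × (Fin ϑ → ℝ) × ℝ → ℝ, ContDiffAt ℝ ∞ f' 0 →
        ‖iteratedFDeriv ℝ 1 (f' - f) 0‖ < ε → (0 < ϑ → dInput f' 0 ≠ 0) := by
      by_cases h : 0 < ϑ
      · have hi' := hi h
        rw [dInput_eq_iteratedFDeriv h] at hi'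
        obtain ⟨ε, hε, h'⟩ := exists_jet_functional_ne _ hf hi'
        refine ⟨ε, hε, fun f' hf' hlt _ => ?_⟩
        rw [dInput_eq_iteratedFDeriv h]
        exact h' f' hf' hlt
      · exact ⟨1, one_pos, fun _ _ _ h' => absurd h' h⟩
    refine ⟨max n 2, min ε (min ε₁ ε₂), by positivity, fun f' hf' hlt => ?_⟩
    have hs' := contDiffAt_of_mem_bifClass hf'
    refine ⟨hn f' hf' fun i hi => ?_, ?_, h₁ f' hs' ?_⟩
    · exact (hlt i (hi.trans (le_max_left _ _))).trans_le (min_le_left _ _)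
    · rw [crossing_eq_iteratedFDeriv hs']
      exact h₂ f' hs' ((hlt 2 (le_max_right _ _)).trans_le
        ((min_le_right _ _).trans (min_le_right _ _)))
    · exact (hlt 1 (le_max_of_le_right one_le_two)).trans_le
        ((min_le_right _ _).trans (min_le_left _ _))
  · intro f hf n R ε hε
    obtain ⟨f', hf'G, hsm, hclose⟩ := hdense f hf n R (ε / 2) (half_pos hε)
    have hs' := contDiffAt_of_mem_bifClass (hG hf'G)
    obtain ⟨n', ε', hε', hn'⟩ := hopen f' hf'G
    obtain ⟨M, hM, hbound⟩ := exists_jet_bound (contDiff_perturbation (ϑ := ϑ) (μ := μ)) (max n n')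
      (max R 0)
    -- a small step that avoids the two values of `t` at which a nondegeneracy condition fails
    obtain ⟨t, ht, htne⟩ : ∃ t, t ∈ Set.Ioo 0 (min (ε / 2) ε' / M) ∧
        t ∉ ({-crossing μ f', -dInput f' 0} : Set ℝ) := by
      have hinf : (Set.Ioo 0 (min (ε / 2) ε' / M)).Infinite := Set.Ioo_infinite (by positivity)
      exact hinf.exists_notMem_finite (Set.toFinite _)
    simp only [Set.mem_insert_iff, Set.mem_singleton_iff, not_or] at htne
    have hsmall : ∀ i ≤ max n n', ∀ x : ℝ × (Fin ϑ → ℝ) × ℝ, ‖x‖ ≤ max R 0 →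
        ‖iteratedFDeriv ℝ i (t • perturbation ϑ μ) x‖ < min (ε / 2) ε' := by
      intro i hi x hx
      rw [iteratedFDeriv_const_smul_apply (contDiff_perturbation.contDiffAt.of_le
        (by exact_mod_cast le_top)), norm_smul, Real.norm_of_nonneg ht.1.le]
      calc t * ‖iteratedFDeriv ℝ i (perturbation ϑ μ) x‖ ≤ t * M :=
            mul_le_mul_of_nonneg_left (hbound i hi x hx) ht.1.le
        _ < min (ε / 2) ε' := (lt_div_iff₀ hM).1 ht.2
    have hsub : f' + t • perturbation ϑ μ - f' = t • perturbation ϑ μ := by abel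
    have hsub' : f' + t • perturbation ϑ μ - f = (f' - f) + t • perturbation ϑ μ := by abel
    have hts : ContDiff ℝ ∞ (t • perturbation ϑ μ) := contDiff_perturbation.const_smul t
    refine ⟨f' + t • perturbation ϑ μ, ⟨hn' _ (add_smul_perturbation_mem (hG hf'G) t)
      fun i hi => ?_, ?_, ?_⟩, ?_, fun i hi x hx => ?_⟩
    · rw [hsub]
      exact (hsmall i (hi.trans (le_max_right _ _)) 0 (by simp)).trans_le (min_le_right _ _)
    · rw [crossing_add_smul_perturbation hs']
      exact fun h => htne.1 (by linarith)
    · intro h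
      rw [dInput_add_smul_perturbation hs', dInput_perturbation, if_pos h]
      exact fun h => htne.2 (by linarith)
    · rw [hsub']
      exact hsm.add hts
    · rw [hsub', iteratedFDeriv_add_apply (hsm.contDiffAt.of_le (by exact_mod_cast le_top))
        (hts.contDiffAt.of_le (by exact_mod_cast le_top))]
      refine (norm_add_le _ _).trans_lt ?_
      have h1 := hclose i hi x hx
      have h2 := (hsmall i (hi.trans (le_max_left _ _)) x (hx.trans (le_max_left _ _))).trans_le
        (min_le_left _ _)
      linarith

lemma Generically.mono {P Q : (ℝ × (Fin ϑ → ℝ) × ℝ → ℝ) → Prop} (h : Generically ϑ μ P)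
    (hPQ : ∀ f, P f → Q f) : Generically ϑ μ Q := by
  obtain ⟨G, hG, hopen, hdense, hP⟩ := h
  exact ⟨G, hG, hopen, hdense, fun f hf => hPQ f (hP f hf)⟩

end Genericity

/-! ### Kernels of dimension two -/

section Planar

variable {C E : Type*} {ϑ : ℕ} [Fintype C] [Finite E] {N : RegularNetwork C E ϑ}
  {f : ℝ × (Fin ϑ → ℝ) × ℝ → ℝ} {v w : Fin 2 → C → ℝ} {μ b : ℝ}
  {g : (Fin 2 → ℝ) × ℝ → (Fin 2 → ℝ)} {W : (Fin 2 → ℝ) × ℝ → (C → ℝ)}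

lemma dot_sum_mul_sum (v w : Fin 2 → C → ℝ) (u : Fin 2 → ℝ) (i : Fin 2) :
    w i ⬝ᵥ ((∑ j, u j • v j) * ∑ j, u j • v j) =
      u 0 ^ 2 * dCoef v w i 0 0 + 2 * (u 0 * u 1) * dCoef v w i 0 1 +
        u 1 ^ 2 * dCoef v w i 1 1 := by
  simp only [dCoef, Fin.sum_univ_two, add_mul, mul_add, dotProduct_add, smul_mul_smul_comm,
    dotProduct_smul, smul_eq_mul, mul_comm (v 1) (v 0)]
  ring

/-- On the unit circle, the zeros of `h̃` are the points at which `Q` is radial. -/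
lemma hTilde_eq_zero {a : ℝ} (ha : a ≠ 0) {Q : (Fin 2 → ℝ) → Fin 2 → ℝ} {u : Fin 2 → ℝ}
    (hu : u ⬝ᵥ u = 1) (hQ : u 0 * Q u 1 = u 1 * Q u 0) : hTilde a Q u = 0 := by
  have hu' : u 0 * u 0 + u 1 * u 1 = 1 := by
    rw [← hu, dotProduct, Fin.sum_univ_two]
  have h1 : ∀ i, hTilde a Q u i = -(Q u 0 * u 0 + Q u 1 * u 1) * u i + Q u i := by
    intro i
    simp only [hTilde, blowUp, etaTilde, Pi.add_apply, Pi.smul_apply, smul_eq_mul, dotProduct,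
      Fin.sum_univ_two]
    field_simp
  ext i
  rw [h1]
  fin_cases i
  · simp only [Fin.zero_eta, Pi.zero_apply]
    linear_combination -(Q u 0) * hu' - u 1 * hQ
  · simp only [Fin.mk_one, Pi.zero_apply]
    linear_combination -(Q u 1) * hu' + u 0 * hQ

/-- If the direction of `v p` is a nondegenerate zero of the blown-up map, then
`2 d_{qpq} ≠ d_{ppp}`. -/
lemma ne_of_isNondegenerateZero (hf : IsResponse f) (hH : HessianOnKernel N f μ b)
    (ha : crossing μ f ≠ 0)
    (hb : IsReductionBasis N f v w) (h : IsReductionVia N f v w g W) {p q : Fin 2} (hpq : q ≠ p)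
    (hnd : IsNondegenerateZero (crossing μ f) (taylorForm 2 g) (Pi.single p 1)) :
    2 * dCoef v w q p q ≠ dCoef v w p p p := by
  intro heq
  have hsum : ∀ i, ∑ j, (Pi.single i 1 : Fin 2 → ℝ) j • v j = v i := fun i => by
    simp [Pi.single_apply]
  have hη : etaTilde (crossing μ f) (taylorForm 2 g) (Pi.single p 1) =
      -(2⁻¹ * (b * dCoef v w p p p)) / crossing μ f := by
    rw [etaTilde, dotProduct_single_one, taylorForm_two_apply hf hH hb h, hsum]
    rfl
  have hker := hnd (Pi.single q 1) (-(b * dCoef v w p p q) / crossing μ f) (by simp [hpq]) ?_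
  · have := congrFun hker.1 q
    simp at this
  rw [fderiv_blowUp hf hH hb h]
  ext i
  rw [fderiv_fderiv_reduction_eq hf hH hb h]
  simp only [hsum, hη]
  have hi : i = p ∨ i = q := by omega
  rcases hi with rfl | rfl
  · rw [Pi.single_eq_same, Pi.single_eq_of_ne hpq.symm]
    simp only [dCoef, Pi.zero_apply]
    field_simp
    ring
  · rw [Pi.single_eq_same, Pi.single_eq_of_ne hpq]
    simp only [dCoef, Pi.zero_apply] at heq ⊢
    field_simp
    linear_combination b * heq

end Planar

section Accumulation

variable {C E : Type*} {ϑ : ℕ} [Finite E] {N : RegularNetwork C E ϑ} {r : Setoid C}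
  {f : ℝ × (Fin ϑ → ℝ) × ℝ → ℝ}

/-- A branch with exactly synchrony `r` on `N` comes from zeros of the quotient field that accumulate
at the origin outside the polydiagonal of any strictly coarser balanced coloring. -/
lemma exists_zeros_of_supportsBranch (hf : IsResponse f) (hr : N.IsBalanced r)
    (h : SupportsBranch N f r) {s : Setoid C} (hs : N.IsBalanced s) (hrs : r < s) :
    ∃ (x : ℝ → Quotient r → ℝ) (t : ℝ → ℝ) (l : Filter ℝ), l.NeBot ∧
      Filter.Tendsto x l (𝓝 0) ∧ Filter.Tendsto t l (𝓝 0) ∧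
      (∀ᶠ z in l, (N.quotient r).field f (x z, t z) = 0) ∧
      ∀ᶠ z in l, x z ∉ polydiagonal (s.comap Quotient.out) := by
  obtain ⟨δ, β, ⟨hδ, hd, h0, hz⟩, hsync, hexact⟩ := h
  let x : ℝ → Quotient r → ℝ := fun z q => (β z).1 q.out
  have hx : ∀ z ∈ Set.Ico 0 δ, liftVec (x z) = (β z).1 := fun z hz => by
    ext c
    exact hsync z hz _ _ (Quotient.exact (Quotient.out_eq (Quotient.mk r c)))
  have hβ : Filter.Tendsto β (𝓝[>] 0) (𝓝 0) := by
    have h1 := (hd 0 ⟨le_rfl, hδ⟩).continuousWithinAt.tendsto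
    rw [h0] at h1
    refine h1.mono_left ?_
    rw [← nhdsWithin_Ioo_eq_nhdsGT hδ]
    exact nhdsWithin_mono 0 Set.Ioo_subset_Ico_self
  have hxt : Filter.Tendsto x (𝓝[>] 0) (𝓝 0) := by
    rw [tendsto_pi_nhds]
    intro q
    exact (tendsto_pi_nhds.1 hβ.fst_nhds) q.out
  let S : Set ℝ := {z | (β z).1 ∉ polydiagonal s}
  refine ⟨x, fun z => (β z).2, 𝓝[>] 0 ⊓ Filter.principal S, ?_, hxt.mono_left inf_le_left,
    hβ.snd_nhds.mono_left inf_le_left, ?_, ?_⟩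
  · rw [← Filter.frequently_mem_iff_neBot, Filter.frequently_iff]
    intro V hV
    obtain ⟨ε, hε, hεV⟩ := mem_nhdsGT_iff_exists_Ioo_subset.1 hV
    obtain ⟨z, hz1, hz2⟩ := hexact s hs hrs (min ε δ) ⟨lt_min hε hδ, min_le_right _ _⟩
    have hz0 : z ≠ 0 := by
      rintro rfl
      refine hz2 ?_
      rw [h0]
      exact Submodule.zero_mem _
    exact ⟨z, hεV ⟨lt_of_le_of_ne hz1.1 hz0.symm, hz1.2.trans_le (min_le_left _ _)⟩, hz2⟩
  · refine Filter.Eventually.filter_mono inf_le_left ?_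
    filter_upwards [Ioo_mem_nhdsGT hδ] with z hz'
    apply liftVec_injective
    have h1 := field_liftVec hr hf.symm (x z) (β z).2
    rw [hx z ⟨hz'.1.le, hz'.2⟩] at h1
    exact h1.symm.trans ((hz z hz').2.1)
  · filter_upwards [Filter.mem_inf_of_left (Ioo_mem_nhdsGT hδ),
      Filter.mem_inf_of_right (Filter.mem_principal_self S)] with z hz' hzS hmem
    rw [mem_polydiagonal_comap_out hrs.le, hx z ⟨hz'.1.le, hz'.2⟩] at hmem
    exact hzS hmem

end Accumulation

/-! ### Submaximal colorings of type one and two -/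

section Submaximal

variable {C E : Type*} {ϑ : ℕ} [Fintype C] [Finite E] {N : RegularNetwork C E ϑ} {r : Setoid C}
  {f : ℝ × (Fin ϑ → ℝ) × ℝ → ℝ} {v w : Fin 2 → Quotient r → ℝ} {μ b : ℝ}

/-- Since `μ` is a simple eigenvalue of the quotient by a `μ`-simple component, the polydiagonal of
the component meets the kernel only in the line spanned by `v p`. -/
lemma eq_zero_of_mem_simple_component (hr : N.IsBalanced r) {s : Setoid C} (hs : N.IsBalanced s)
    (hrs : r < s) (h1 : algMult (N.quotient s).adjacency μ = 1)
    (hb : IsReductionBasis (N.quotient r) f v w)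
    (heig : ∀ x, (N.quotient r).jac f x = 0 → (N.quotient r).adjacency.mulVec x = μ • x)
    {p : Fin 2} (hp : liftVec (v p) ∈ polydiagonal s) (u : Fin 2 → ℝ)
    (hu : ∑ i, u i • v i ∈ polydiagonal (s.comap Quotient.out)) : ∀ i ≠ p, u i = 0 := by
  intro q hqp
  by_contra hq
  have hp' := (mem_polydiagonal_comap_out hrs.le).2 hp
  have hvq : v q ∈ polydiagonal (s.comap Quotient.out) := by
    have hsum : ∑ i, u i • v i = u p • v p + u q • v q :=
      Fintype.sum_eq_add p q hqp.symm fun i hi => by omega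
    have : v q = (u q)⁻¹ • (∑ i, u i • v i - u p • v p) := by
      rw [hsum, add_sub_cancel_left, inv_smul_smul₀ hq]
    rw [this]
    exact Submodule.smul_mem _ _ (Submodule.sub_mem _ hu (Submodule.smul_mem _ _ hp'))
  have hall : ∀ i, v i ∈ polydiagonal (s.comap Quotient.out) := fun i => by
    have hi : i = p ∨ i = q := by omega
    rcases hi with rfl | rfl
    exacts [hp', hvq]
  refine not_linearIndependent_of_algMult_eq_one hs h1 (x := fun i => liftVec (v i)) (fun i => ?_)
    (fun i => (mem_polydiagonal_comap_out hrs.le).1 (hall i))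
    (hb.1.map' (liftLin r) (LinearMap.ker_eq_bot.2 liftVec_injective))
  rw [adjacency_mulVec_liftVec hr, heig _ ((hb.2.1 _).1 (Submodule.subset_span ⟨i, rfl⟩))]
  rfl

/-- A zero of the blown-up map outside the polydiagonals of the `μ`-simple components is
nondegenerate by (H1a) and is the direction of a branch with exactly synchrony `r`. -/
lemma supportsBranch_of_zero_direction (hf : IsResponse f) (hr : N.IsBalanced r)
    (hH : HessianOnKernel (N.quotient r) f μ b) (ha : crossing μ f ≠ 0)
    (hiso : IsolatedOrigin N f) (hb : IsReductionBasis (N.quotient r) f v w)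
    (heig : ∀ x, (N.quotient r).jac f x = 0 → (N.quotient r).adjacency.mulVec x = μ • x)
    (hH1a : CondH1a (N.quotient r) μ 2 f v w) {j : ℕ} {comp : Fin (j + 1) → Setoid C}
    (hsub : IsSubmaximal N μ r (j + 1) comp) {u : Fin 2 → ℝ}
    (hu : ∀ i, liftVec (∑ k, u k • v k) ∉ polydiagonal (comp i))
    (hz : u 0 * (u 0 ^ 2 * dCoef v w 1 0 0 + 2 * (u 0 * u 1) * dCoef v w 1 0 1 +
        u 1 ^ 2 * dCoef v w 1 1 1) =
      u 1 * (u 0 ^ 2 * dCoef v w 0 0 0 + 2 * (u 0 * u 1) * dCoef v w 0 0 1 +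
        u 1 ^ 2 * dCoef v w 0 1 1)) :
    SupportsBranch N f r := by
  obtain ⟨g, ⟨W, hW, hW0, hWe⟩, hH1a⟩ := hH1a
  have h : IsReductionVia (N.quotient r) f v w g W := ⟨hW, hW0, hWe⟩
  have hu0 : u ⬝ᵥ u ≠ 0 := fun h0 => by
    refine hu 0 ?_
    rw [dotProduct_self_eq_zero.1 h0]
    simp only [Pi.zero_apply, zero_smul, Finset.sum_const_zero]
    exact Submodule.zero_mem _
  have hpos : 0 < u ⬝ᵥ u := lt_of_le_of_ne
    (Finset.sum_nonneg fun i _ => mul_self_nonneg (u i)) hu0.symm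
  -- (H1a) is about unit vectors
  obtain ⟨c, hc, hc1⟩ : ∃ c : ℝ, c ≠ 0 ∧ c * (c * (u ⬝ᵥ u)) = 1 := by
    refine ⟨(√(u ⬝ᵥ u))⁻¹, by positivity, ?_⟩
    have := Real.mul_self_sqrt hpos.le
    field_simp
    rw [sq, this]
  have hn : (c • u) ⬝ᵥ (c • u) = 1 := by
    rw [smul_dotProduct, dotProduct_smul, smul_eq_mul, smul_eq_mul, hc1]
  have hsum : ∑ k, (c • u) k • v k = c • ∑ k, u k • v k := by
    simp [smul_smul]
  have hu' : ∀ i, liftVec (∑ k, (c • u) k • v k) ∉ polydiagonal (comp i) := fun i hmem => by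
    rw [hsum] at hmem
    have : c • liftVec (∑ k, u k • v k) ∈ polydiagonal (comp i) := hmem
    exact hu i ((Submodule.smul_mem_iff _ hc).1 this)
  have hzero : hTilde (crossing μ f) (taylorForm 2 g) (c • u) = 0 := by
    refine hTilde_eq_zero ha hn ?_
    rw [taylorForm_two_apply hf hH hb h, taylorForm_two_apply hf hH hb h, dot_sum_mul_sum,
      dot_sum_mul_sum]
    simp only [Pi.smul_apply, smul_eq_mul]
    linear_combination 2⁻¹ * b * c ^ 3 * hz
  obtain ⟨hbal, hlt, -⟩ := hsub.2.2.2.1 0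
  have hnd := hH1a (c • u) ((comp 0).comap Quotient.out) hn hzero
    (isBalanced_comap_out hbal hlt.le) (bot_lt_comap_out hlt)
    (fun hmem => hu' 0 ((mem_polydiagonal_comap_out hlt.le).1 hmem))
  obtain ⟨δ, β, hβ, hdir⟩ := exists_branch_of_nondegenerate hf hH hb h
    (isolatedOrigin_quotient hf hr hiso) hn hzero hnd
  refine supportsBranch_of_quotient hf hr hβ hdir
    (notMem_polydiagonal_of_submaximal hsub (heig _ (hb.jac_sum _)) (fun h0 => ?_) hu')
  refine hu' 0 ?_
  rw [h0]
  exact Submodule.zero_mem _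

/-- The coordinate directions are zeros of the blown-up map when the corresponding coefficient
vanishes, and then (H1a) makes them nondegenerate. -/
lemma ne_of_condH1a (hf : IsResponse f) (hH : HessianOnKernel (N.quotient r) f μ b)
    (ha : crossing μ f ≠ 0) (hb : IsReductionBasis (N.quotient r) f v w)
    (hH1a : CondH1a (N.quotient r) μ 2 f v w) {p q : Fin 2} (hpq : q ≠ p)
    (hd : dCoef v w q p p = 0) {s : Setoid (Quotient r)} (hs : (N.quotient r).IsBalanced s)
    (hs0 : ⊥ < s) (hv : v p ∉ polydiagonal s) :
    2 * dCoef v w q p q ≠ dCoef v w p p p := by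
  obtain ⟨g, ⟨W, hW, hW0, hWe⟩, hH1a⟩ := hH1a
  have h : IsReductionVia (N.quotient r) f v w g W := ⟨hW, hW0, hWe⟩
  have hsum : ∑ j, (Pi.single p 1 : Fin 2 → ℝ) j • v j = v p := by
    simp [Pi.single_apply]
  refine ne_of_isNondegenerateZero hf hH ha hb h hpq
    (hH1a _ s (by simp) (hTilde_eq_zero ha (by simp) ?_) hs hs0 (by rwa [hsum]))
  have hq : taylorForm 2 g (Pi.single p 1) q = 0 := by
    rw [taylorForm_two_apply hf hH hb h, hsum]
    change 2⁻¹ * (b * dCoef v w q p p) = 0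
    rw [hd, mul_zero, mul_zero]
  have hcases : p = 0 ∧ q = 1 ∨ p = 1 ∧ q = 0 := by omega
  rcases hcases with ⟨rfl, rfl⟩ | ⟨rfl, rfl⟩
  · simp [hq]
  · simp [hq]

/-- The case of a single `μ`-simple component: the zeros of the blown-up map outside the line of
`v 0` are those of a binary quadratic form, with a nonzero coefficient of `u 0 ^ 2`. -/
lemma supportsBranch_iff_of_type_one (hf : IsResponse f) (hr : N.IsBalanced r)
    (hH : HessianOnKernel (N.quotient r) f μ b) (hb0 : b ≠ 0) (ha : crossing μ f ≠ 0)
    (hiso : IsolatedOrigin N f) (hb : IsReductionBasis (N.quotient r) f v w)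
    (heig : ∀ x, (N.quotient r).jac f x = 0 → (N.quotient r).adjacency.mulVec x = μ • x)
    (hH1a : CondH1a (N.quotient r) μ 2 f v w) {comp : Fin 1 → Setoid C}
    (hsub : IsSubmaximal N μ r 1 comp) (hv : liftVec (v 0) ∈ polydiagonal (comp 0)) :
    SupportsBranch N f r ↔
      (dCoef v w 1 1 1 - 2 * dCoef v w 0 0 1) ^ 2 ≥
        4 * dCoef v w 0 1 1 * (dCoef v w 0 0 0 - 2 * dCoef v w 1 0 1) := by
  obtain ⟨hbal, hlt, hsimple⟩ := hsub.2.2.2.1 0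
  have hsbal := isBalanced_comap_out hbal hlt.le
  have hvs := (mem_polydiagonal_comap_out hlt.le).2 hv
  have hker := eq_zero_of_mem_simple_component hr hbal hlt hsimple hb heig hv
  have hd : dCoef v w 1 0 0 = 0 :=
    dot_eq_zero_of_mem_polydiagonal hf hb hsbal one_ne_zero hker (mul_mem_polydiagonal hvs hvs)
  have hα : 2 * dCoef v w 1 0 1 - dCoef v w 0 0 0 ≠ 0 := by
    rw [sub_ne_zero]
    by_cases htop : v 0 ∈ polydiagonal (⊤ : Setoid (Quotient r))
    · -- on a constant `v 0` both coefficients are equal to the constant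
      obtain ⟨κ, hκ⟩ : ∃ κ, ∀ q, v 0 q = κ := by
        rcases isEmpty_or_nonempty (Quotient r) with _ | ⟨⟨q₀⟩⟩
        · exact ⟨0, fun q => isEmptyElim q⟩
        · exact ⟨v 0 q₀, fun q => htop q q₀ trivial⟩
      have hmul : ∀ y : Quotient r → ℝ, v 0 * y = κ • y := fun y => by
        ext q; simp [hκ]
      have hκ0 : κ ≠ 0 := by
        rintro rfl
        exact hb.1.ne_zero 0 (funext hκ)
      have h1 : dCoef v w 1 0 1 = κ := by
        rw [dCoef, hmul, dotProduct_smul, hb.2.2.2.2]; simp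
      have h2 : dCoef v w 0 0 0 = κ := by
        rw [dCoef, hmul, dotProduct_smul, hb.2.2.2.2]; simp
      rw [h1, h2]
      intro h
      exact hκ0 (by linarith)
    · exact ne_of_condH1a hf hH ha hb hH1a one_ne_zero hd (isBalanced_top _)
        (bot_lt_top_of_lt hlt) htop
  constructor
  · intro hbranch
    obtain ⟨x, t, l, hl, hx, ht, hz, hxs⟩ := exists_zeros_of_supportsBranch hf hr hbranch hbal hlt
    obtain ⟨u, η, hu0, hu, hu1⟩ := exists_limit_direction hf hH ha hb hsbal hvs hker hx ht hz hxs
    have e0 := hu 0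
    have e1 := hu 1
    rw [dot_sum_mul_sum] at e0 e1
    by_cases hu1' : u 1 = 0
    · -- the direction of `v 0` is nondegenerate, so no branch leaves the polydiagonal along it
      exfalso
      have hu00 : u 0 ≠ 0 := fun h => hu0 (funext fun i => by
        fin_cases i
        exacts [h, hu1'])
      have e2 := hu1 hu1'
      change η * crossing μ f + b * (u 0 * dCoef v w 1 0 1) = 0 at e2
      rw [hu1'] at e0
      have : b * u 0 ^ 2 * (2 * dCoef v w 1 0 1 - dCoef v w 0 0 0) = 0 := by
        linear_combination 2 * u 0 * e2 - 2 * e0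
      simp [hb0, hu00, hα] at this
    · have hq : (2 * dCoef v w 1 0 1 - dCoef v w 0 0 0) * u 0 ^ 2 +
          (dCoef v w 1 1 1 - 2 * dCoef v w 0 0 1) * (u 0 * u 1) - dCoef v w 0 1 1 * u 1 ^ 2 = 0 := by
        have : b * u 1 * ((2 * dCoef v w 1 0 1 - dCoef v w 0 0 0) * u 0 ^ 2 +
          (dCoef v w 1 1 1 - 2 * dCoef v w 0 0 1) * (u 0 * u 1) -
            dCoef v w 0 1 1 * u 1 ^ 2) = 0 := by
          linear_combination 2 * u 0 * e1 - 2 * u 1 * e0 - b * u 0 ^ 3 * hd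
        exact (mul_eq_zero.1 this).resolve_left (mul_ne_zero hb0 hu1')
      have hsq : 0 < u 1 ^ 2 := by positivity
      have hdisc : 0 ≤ u 1 ^ 2 * ((dCoef v w 1 1 1 - 2 * dCoef v w 0 0 1) ^ 2 -
          4 * dCoef v w 0 1 1 * (dCoef v w 0 0 0 - 2 * dCoef v w 1 0 1)) := by
        have hs := sq_nonneg (2 * (2 * dCoef v w 1 0 1 - dCoef v w 0 0 0) * u 0 +
          (dCoef v w 1 1 1 - 2 * dCoef v w 0 0 1) * u 1)
        refine hs.trans_eq ?_
        linear_combination 4 * (2 * dCoef v w 1 0 1 - dCoef v w 0 0 0) * hq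
      linarith [nonneg_of_mul_nonneg_right hdisc hsq]
  · intro hdisc
    obtain ⟨u₀, hu₀⟩ := exists_quadratic_eq_zero (a := 2 * dCoef v w 1 0 1 - dCoef v w 0 0 0)
      (b := dCoef v w 1 1 1 - 2 * dCoef v w 0 0 1) (c := -dCoef v w 0 1 1) hα
      ⟨√((dCoef v w 1 1 1 - 2 * dCoef v w 0 0 1) ^ 2 -
          4 * dCoef v w 0 1 1 * (dCoef v w 0 0 0 - 2 * dCoef v w 1 0 1)), by
        rw [Real.mul_self_sqrt (by linarith), discrim]
        ring⟩
    refine supportsBranch_of_zero_direction hf hr hH ha hiso hb heig hH1a hsub (u := ![u₀, 1])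
      (fun i hmem => ?_) ?_
    · rw [Subsingleton.elim (α := Fin 1) i 0, ← mem_polydiagonal_comap_out hlt.le] at hmem
      exact one_ne_zero (hker _ hmem 1 one_ne_zero)
    · simp only [Matrix.cons_val_zero, Matrix.cons_val_one, hd]
      linear_combination hu₀

/-- The case of two `μ`-simple components: (H1a) makes both coordinate directions nondegenerate, so
that there is always a third direction of a branch. -/
lemma supportsBranch_of_type_two (hf : IsResponse f) (hr : N.IsBalanced r)
    (hH : HessianOnKernel (N.quotient r) f μ b) (ha : crossing μ f ≠ 0)
    (hiso : IsolatedOrigin N f) (hb : IsReductionBasis (N.quotient r) f v w)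
    (heig : ∀ x, (N.quotient r).jac f x = 0 → (N.quotient r).adjacency.mulVec x = μ • x)
    (hH1a : CondH1a (N.quotient r) μ 2 f v w) {comp : Fin 2 → Setoid C}
    (hsub : IsSubmaximal N μ r 2 comp) (hv₀ : liftVec (v 0) ∈ polydiagonal (comp 0))
    (hv₁ : liftVec (v 1) ∈ polydiagonal (comp 1)) :
    SupportsBranch N f r ∧
      (2 * dCoef v w 1 0 1 - dCoef v w 0 0 0) * (2 * dCoef v w 0 0 1 - dCoef v w 1 1 1) ≠ 0 := by
  obtain ⟨hbal₀, hlt₀, hsimple₀⟩ := hsub.2.2.2.1 0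
  obtain ⟨hbal₁, hlt₁, hsimple₁⟩ := hsub.2.2.2.1 1
  have hker₀ := eq_zero_of_mem_simple_component hr hbal₀ hlt₀ hsimple₀ hb heig hv₀
  have hker₁ := eq_zero_of_mem_simple_component hr hbal₁ hlt₁ hsimple₁ hb heig hv₁
  have hvs₀ := (mem_polydiagonal_comap_out hlt₀.le).2 hv₀
  have hvs₁ := (mem_polydiagonal_comap_out hlt₁.le).2 hv₁
  have hd₀ : dCoef v w 1 0 0 = 0 := dot_eq_zero_of_mem_polydiagonal hf hb
    (isBalanced_comap_out hbal₀ hlt₀.le) one_ne_zero hker₀ (mul_mem_polydiagonal hvs₀ hvs₀)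
  have hd₁ : dCoef v w 0 1 1 = 0 := dot_eq_zero_of_mem_polydiagonal hf hb
    (isBalanced_comap_out hbal₁ hlt₁.le) zero_ne_one hker₁ (mul_mem_polydiagonal hvs₁ hvs₁)
  have hsum : ∀ i, ∑ j, (Pi.single i 1 : Fin 2 → ℝ) j • v j = v i := fun i => by
    simp [Pi.single_apply]
  have hn₀ : v 0 ∉ polydiagonal ((comp 1).comap Quotient.out) := fun hmem => by
    simpa using hker₁ (Pi.single 0 1) (by rwa [hsum]) 0 zero_ne_one
  have hn₁ : v 1 ∉ polydiagonal ((comp 0).comap Quotient.out) := fun hmem => by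
    simpa using hker₀ (Pi.single 1 1) (by rwa [hsum]) 1 one_ne_zero
  have hα := sub_ne_zero.2 (ne_of_condH1a hf hH ha hb hH1a one_ne_zero hd₀
    (isBalanced_comap_out hbal₁ hlt₁.le) (bot_lt_comap_out hlt₁) hn₀)
  have hβ := sub_ne_zero.2 (ne_of_condH1a hf hH ha hb hH1a zero_ne_one hd₁
    (isBalanced_comap_out hbal₀ hlt₀.le) (bot_lt_comap_out hlt₀) hn₁)
  have hsymm : dCoef v w 0 1 0 = dCoef v w 0 0 1 := by rw [dCoef, dCoef, mul_comm]
  rw [hsymm] at hβ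
  refine ⟨supportsBranch_of_zero_direction hf hr hH ha hiso hb heig hH1a hsub
    (u := ![2 * dCoef v w 0 0 1 - dCoef v w 1 1 1, 2 * dCoef v w 1 0 1 - dCoef v w 0 0 0])
    (fun i hmem => ?_) ?_, mul_ne_zero hα hβ⟩
  · fin_cases i
    · exact hα (hker₀ _ ((mem_polydiagonal_comap_out hlt₀.le).2 hmem) 1 one_ne_zero)
    · exact hβ (hker₁ _ ((mem_polydiagonal_comap_out hlt₁.le).2 hmem) 0 zero_ne_one)
  · simp only [Matrix.cons_val_zero, Matrix.cons_val_one, hd₀, hd₁]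
    ring

/-- Without inputs the only eigenvalue of the adjacency matrix is zero. -/
lemma eigenvalue_eq_zero_of_no_inputs (N : RegularNetwork C E 0)
    (h : Module.End.HasEigenvalue N.adjacency.mulVecLin μ) : μ = 0 := by
  obtain ⟨x, hx⟩ := h.exists_hasEigenvector
  have h1 : N.adjacency.mulVec x = 0 := funext fun c => by rw [← sum_inputs]; simp
  have h2 := hx.apply_eq_smul
  rw [Matrix.mulVecLin_apply, h1] at h2
  exact (smul_eq_zero.1 h2.symm).resolve_right hx.2

end Submaximal

theorem mainTheorem2 {C E : Type*} [Fintype C] [Finite E] {ϑ : ℕ} (N : RegularNetwork C E ϑ)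
    (r : Setoid C) (hr : N.IsBalanced r) (μ : ℝ)
    (hμ : IsSemisimpleEigenvalue N.adjacency μ)
    (hk : HasGenericOrder (N.quotient r) μ 2) :
    Generically ϑ μ fun f => IsolatedOrigin N f →
      Module.finrank ℝ ↥(LinearMap.ker (N.jac f).toLinearMap ⊓ polydiagonal r) = 2 →
      ∀ v w : Fin 2 → Quotient r → ℝ, IsReductionBasis (N.quotient r) f v w →
        CondH1a (N.quotient r) μ 2 f v w →
        (∀ comp : Fin 1 → Setoid C, IsSubmaximal N μ r 1 comp →
          liftVec (v 0) ∈ polydiagonal (comp 0) →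
          (SupportsBranch N f r ↔
            (dCoef v w 1 1 1 - 2 * dCoef v w 0 0 1) ^ 2 ≥
              4 * dCoef v w 0 1 1 * (dCoef v w 0 0 0 - 2 * dCoef v w 1 0 1))) ∧
        (∀ comp : Fin 2 → Setoid C, IsSubmaximal N μ r 2 comp →
          liftVec (v 0) ∈ polydiagonal (comp 0) → liftVec (v 1) ∈ polydiagonal (comp 1) →
          (SupportsBranch N f r ↔
            (2 * dCoef v w 1 0 1 - dCoef v w 0 0 0) *
              (2 * dCoef v w 0 0 1 - dCoef v w 1 1 1) ≠ 0)) := by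
  refine (Generically.and_nondegenerate hk).mono fun f hgen hiso _ v w hb hH1a => ?_
  obtain ⟨horder, hfμ, ha, hinput⟩ := hgen
  have hf := isResponse_of_mem_bifClass hfμ
  have h1 : dInput f 0 ≠ 0 ∨ ϑ = 0 ∧ μ = 0 := by
    rcases Nat.eq_zero_or_pos ϑ with rfl | hpos
    · exact Or.inr ⟨rfl, eigenvalue_eq_zero_of_no_inputs N hμ.1⟩
    · exact Or.inl (hinput hpos)
  obtain ⟨b, hH⟩ := exists_hessianOnKernel (N := N.quotient r) hf hfμ.2.2.2 h1
  have hb0 := ne_zero_of_hasOrder_two hf hH horder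
  have heig := (eigen_of_jac (N := N.quotient r) hf hfμ.2.2.2 h1).1
  refine ⟨fun comp hsub hv => supportsBranch_iff_of_type_one hf hr hH hb0 ha hiso hb heig hH1a
    hsub hv, fun comp hsub hv₀ hv₁ => ?_⟩
  obtain ⟨hbranch, hne⟩ :=
    supportsBranch_of_type_two hf hr hH ha hiso hb heig hH1a hsub hv₀ hv₁
  exact iff_of_true hbranch hne
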